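/- Let $d\ge 1$ and let $X_1,X_2,\dots$ be i.i.d. random vectors in $\mathbb{R}^d$ with probability density $f$ with respect to Lebesgue measure. Let $c_d$ be the volume of the unit Euclidean ball of $\mathbb{R}^d$, and let $d_{\rm TV}(\mu,\nu)=\sup_A|\mu(A)-\nu(A)|$ (supremum over measurable sets $A$) be the total variation distance; between random vectors, it is the distance between their laws. Let $E_1,E_2,\dots$ be i.i.d. standard exponential random variables and let $\xi_1,\xi_2,\dots$ be i.i.d. random vectors distributed uniformly on the unit sphere $\{u\in\mathbb{R}^d:\|u\|=1\}$, independent of the $E_j$'s. Let $x\in\mathbb{R}^d$ and suppose that there is $\varepsilon>0$ such that on the ball $\{a:\|a-x\|<\varepsilon\}$ the function $f$ is twice continuously differentiable and strictly positive, and its gradient $\nabla f$ and Hessian $H_f$ are bounded. Let $(m_n)$ be any sequence of non-negative integers with $m_n=O(\log n)$ as $n\to\infty$, and for each $n\geq 1$ let $i=i_n\in\{1,\dots,n\}$. For a sample $X_1,\dots,X_n$ let $Z_{\ell,i}=X_{j_\ell}-X_i$, where $X_{j_\ell}$ is the $\ell$-th nearest neighbour of $X_i$ in Euclidean distance among the other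 sample points $X_j$, $1\le j\le n$, $j\ne i$ (ties are broken by the order of the indices; $Z_{\ell,i}=0$ if $\ell\geq n$, which for $\ell\le m_n$ can occur for finitely many $n$ only). For every $n$ and $i$, a regular conditional distribution of $(X_1,\dots,X_n)$ given $X_i$ is obtained as follows: given $X_i=z$, the $i$-th point equals $z$ and the points $X_j$, $j\neq i$, are i.i.d. with density $f$. With this conditional distribution given $X_i=x$, $$\lim_{n\to\infty} d_{\rm TV}\Big( (c_d\,n\,f(x))^{1/d}\,\big(Z_{1,i},\dots,Z_{m_n,i}\big)\,,\ \big(\xi_1E_1^{1/d},\ \xi_2(E_1+E_2)^{1/d},\ \dots,\ \xi_{m_n}(E_1+\dots+E_{m_n})^{1/d}\big)\Big)=0 .$$ -/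

import Mathlib

open MeasureTheory ProbabilityTheory Filter Topology

/-- Total variation distance `sup_A |μ A - ν A|` over measurable sets `A`. -/
noncomputable def tvDist {S : Type*} [MeasurableSpace S] (μ ν : Measure S) : ℝ :=
  ⨆ A : {A : Set S // MeasurableSet A}, |μ.real A - ν.real A|

/-- The measure on `ℝ^d` with Lebesgue density `f`. -/
noncomputable def densityMeasure {d : ℕ} (f : EuclideanSpace ℝ (Fin d) → ℝ) :
    Measure (EuclideanSpace ℝ (Fin d)) :=
  volume.withDensity fun y => ENNReal.ofReal (f y)

/-- The uniform probability measure on the unit sphere of `ℝ^d`: normalized surface measure. -/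
noncomputable def uniformSphere (d : ℕ) :
    Measure (Metric.sphere (0 : EuclideanSpace ℝ (Fin d)) 1) :=
  ((volume : Measure (EuclideanSpace ℝ (Fin d))).toSphere Set.univ)⁻¹ •
    (volume : Measure (EuclideanSpace ℝ (Fin d))).toSphere

/-- The volume `c_d` of the unit ball of `ℝ^d`. -/
noncomputable def unitBallVolume (d : ℕ) : ℝ :=
  (volume : Measure (EuclideanSpace ℝ (Fin d))).real (Metric.ball 0 1)

/-- The law of an i.i.d. sample of size `n + 1` from `ρ`, conditioned on the `i`-th sample point
being `x`: the other points are still i.i.d. from `ρ`, and the `i`-th one equals `x`. -/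
noncomputable def condSampleLaw {d n : ℕ} (ρ : Measure (EuclideanSpace ℝ (Fin d)))
    (i : Fin (n + 1)) (x : EuclideanSpace ℝ (Fin d)) :
    Measure (Fin (n + 1) → EuclideanSpace ℝ (Fin d)) :=
  (Measure.pi fun _ : Fin (n + 1) => ρ).map fun y => Function.update y i x

/-- For a sample `y` of `n + 1` points, the vector `y_j - y_i` from `y_i` to its `ℓ`-th nearest
neighbour among the other `n` points, with `ℓ` counted from `0`. Ties in the distance are broken
by the order of the indices; the value is `0` if there are at most `ℓ` other points. -/
noncomputable def nnVector {d n : ℕ} (y : Fin (n + 1) → EuclideanSpace ℝ (Fin d))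
    (i : Fin (n + 1)) (ℓ : ℕ) : EuclideanSpace ℝ (Fin d) :=
  if h : ℓ < n then
    y (i.succAbove (Tuple.sort (fun j : Fin n => ‖y (i.succAbove j) - y i‖) ⟨ℓ, h⟩)) - y i
  else 0

open scoped ENNReal

/-! One-sided domination suffices: if the law of the scaled neighbours is at least `c` times the
limit law `ν` on a set `G`, their total variation distance is at most `(1 - c) + ν Gᶜ`
(`tvDist_le_of_le_on`). So the first law only has to be bounded below and the second above.

Both are compared with the product of `ballVolume`, Lebesgue measure scaled so that the unit ball
has mass 1. The limit law has density at most `exp (-‖z‖ ^ d)`, where the sup norm `‖z‖` of a tuple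
is its largest radius: taking partial sums preserves Lebesgue measure, and polar coordinates turn
`d`-th powers of radii and uniform directions into `ballVolume` (`map_poisson_points_le`). For `n`
other points with scaled density `h`, choosing which of them are the neighbours shows that on tuples
with increasing norms the first law has density at least `n!/(n-m)! · ∏ h(z_k) · P(a scaled point
has norm > ‖z‖)^(n-m)` (`lintegral_le_map_closest`). If `h` lies within `(1 ± η)/(n+1)`, this is at
least `c · exp (-‖z‖ ^ d)` as long as `‖z‖ ^ d ≤ L` (`binomial_density_lower_bound`).

Hence `G` consists of the tuples with increasing norms and `‖z‖ ^ d ≤ L`, and Markov's inequality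
gives `ν Gᶜ ≤ m / L`. With `L = log² (n+1)` the gradient bound gives `η` of order `(L/n)^(1/d)`, and
every error term vanishes when `m = O(log n)`. -/

/-! ### Total variation from one-sided domination -/

theorem tvDist_nonneg {S : Type*} [MeasurableSpace S] (μ ν : Measure S) : 0 ≤ tvDist μ ν :=
  Real.iSup_nonneg fun _ => abs_nonneg _

/-- If `μ` dominates `c • ν` on the measurable subsets of `G`, the total variation distance is at
most `(1 - c) + ν Gᶜ`. -/
theorem tvDist_le_of_le_on {S : Type*} [MeasurableSpace S] (μ ν : Measure S)
    [IsProbabilityMeasure μ] [IsProbabilityMeasure ν] {G : Set S} (hG : MeasurableSet G)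
    {c : ℝ} (hc : c ≤ 1)
    (h : ∀ A, MeasurableSet A → A ⊆ G → c * ν.real A ≤ μ.real A) :
    tvDist μ ν ≤ (1 - c) + ν.real Gᶜ := by
  have key : ∀ A, MeasurableSet A → ν.real A - μ.real A ≤ (1 - c) + ν.real Gᶜ := by
    intro A hA
    have h1 := h (A ∩ G) (hA.inter hG) Set.inter_subset_right
    have h2 : ν.real A = ν.real (A ∩ G) + ν.real (A \ G) :=
      (measureReal_inter_add_sdiff hG).symm
    have h3 : ν.real (A \ G) ≤ ν.real Gᶜ := measureReal_mono (fun x hx => hx.2)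
    have h4 : μ.real (A ∩ G) ≤ μ.real A := measureReal_mono Set.inter_subset_left
    have h5 : ν.real (A ∩ G) ≤ 1 := measureReal_le_one
    nlinarith
  refine Real.iSup_le ?_ ?_
  · rintro ⟨A, hA⟩
    have h1 := key A hA
    -- The opposite sign comes from complements, both measures having mass 1.
    have h2 := key Aᶜ hA.compl
    rw [probReal_compl_eq_one_sub hA, probReal_compl_eq_one_sub hA] at h2
    rw [abs_le]
    constructor <;> linarith
  · have := measureReal_nonneg (μ := ν) (s := Gᶜ)
    linarith

/-! ### Densities, images and products -/

theorem map_withDensity_comp {α β : Type*} [MeasurableSpace α] [MeasurableSpace β]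
    (μ : Measure α) {T : α → β} (hT : Measurable T) {g : β → ℝ≥0∞} (hg : Measurable g) :
    (μ.withDensity fun a => g (T a)).map T = (μ.map T).withDensity g := by
  ext A hA
  rw [Measure.map_apply hT hA, withDensity_apply _ (hT hA), withDensity_apply _ hA,
    setLIntegral_map hA hg hT]

theorem lintegral_pi_prod {m : ℕ} {α : Type*} [MeasurableSpace α] (μ : Fin m → Measure α)
    [∀ i, SigmaFinite (μ i)] (f : Fin m → α → ℝ≥0∞) (hf : ∀ i, Measurable (f i)) :
    ∫⁻ z, ∏ i, f i (z i) ∂Measure.pi μ = ∏ i, ∫⁻ a, f i a ∂μ i := by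
  induction m with
  | zero => simp
  | succ m ih =>
    rw [Fin.prod_univ_succ, ← ih (fun i => μ i.succ) (fun i => f i.succ) fun i => hf _]
    have hmp := (measurePreserving_piFinSuccAbove μ 0).symm
    rw [← hmp.lintegral_comp (f := fun z => ∏ i, f i (z i)) (Finset.measurable_fun_prod _
      fun i _ => (hf i).comp (measurable_pi_apply i))]
    rw [← lintegral_prod_mul (hf 0).aemeasurable]
    · refine lintegral_congr fun p => ?_
      simp [MeasurableEquiv.piFinSuccAbove, Fin.prod_univ_succ]
    · exact (Finset.measurable_fun_prod _ fun i _ =>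
        (hf _).comp (measurable_pi_apply i)).aemeasurable

theorem pi_withDensity {m : ℕ} {α : Type*} [MeasurableSpace α] (μ : Measure α)
    [SigmaFinite μ] (f : α → ℝ≥0∞) (hf : Measurable f) [SigmaFinite (μ.withDensity f)] :
    (Measure.pi fun _ : Fin m => μ.withDensity f) =
      (Measure.pi fun _ : Fin m => μ).withDensity fun z => ∏ i, f (z i) := by
  refine Measure.pi_eq fun s hs => ?_
  rw [withDensity_apply _ (MeasurableSet.univ_pi hs), Measure.restrict_pi_pi,
    lintegral_pi_prod _ (fun _ => f) fun _ => hf]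
  exact Finset.prod_congr rfl fun i _ => (withDensity_apply _ (hs i)).symm

/-! ### Sorting without ties -/

/-- If the first values of `g` in increasing order are attained, without ties, along `σ`, then
`Tuple.sort g` starts with `σ`. -/
theorem sort_eq_of_strictMono {n m : ℕ} (g : Fin n → ℝ) (σ : Fin m → Fin n)
    (hσ : StrictMono (g ∘ σ)) (hlt : ∀ j, j ∉ Set.range σ → ∀ ℓ, g (σ ℓ) < g j)
    (ℓ : Fin m) (h : (ℓ : ℕ) < n) : Tuple.sort g ⟨ℓ, h⟩ = σ ℓ := by
  set τ := Tuple.sort g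
  have hmono : Monotone (g ∘ τ) := Tuple.monotone_sort g
  have huniq : ∀ j, g j = g (σ ℓ) → j = σ ℓ := by
    intro j hj
    by_cases hr : j ∈ Set.range σ
    · obtain ⟨k, rfl⟩ := hr
      rw [hσ.injective (a₁ := k) (a₂ := ℓ) hj]
    · exact absurd hj (hlt j hr ℓ).ne'
  set k := τ.symm (σ ℓ)
  have hk : τ k = σ ℓ := by simp [k]
  -- The indices with value below `g (σ ℓ)` are counted twice: along `σ` there are `ℓ` of them,
  -- along the sorting permutation `k`. Hence `k = ℓ`.
  have c1 : (Finset.univ.filter fun j => g j < g (σ ℓ)).card = (ℓ : ℕ) := by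
    have : (Finset.univ.filter fun j => g j < g (σ ℓ)) = (Finset.Iio ℓ).image σ := by
      ext j
      simp only [Finset.mem_filter, Finset.mem_univ, true_and, Finset.mem_image, Finset.mem_Iio]
      constructor
      · intro hj
        by_cases hr : j ∈ Set.range σ
        · obtain ⟨k, rfl⟩ := hr
          exact ⟨k, hσ.lt_iff_lt.1 hj, rfl⟩
        · exact absurd hj (hlt j hr ℓ).not_gt
      · rintro ⟨a, ha, rfl⟩
        exact hσ ha
    rw [this, Finset.card_image_of_injective _ hσ.injective.of_comp, Fin.card_Iio]
  have c2 : (Finset.univ.filter fun j => g j < g (σ ℓ)).card = (k : ℕ) := by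
    have : (Finset.univ.filter fun j => g j < g (σ ℓ)) = (Finset.Iio k).image τ := by
      ext j
      simp only [Finset.mem_filter, Finset.mem_univ, true_and, Finset.mem_image, Finset.mem_Iio]
      constructor
      · intro hj
        refine ⟨τ.symm j, ?_, by simp⟩
        by_contra hcon
        have := hmono (not_lt.1 hcon)
        simp only [Function.comp_apply, Equiv.apply_symm_apply, hk] at this
        linarith
      · rintro ⟨a, ha, rfl⟩
        refine lt_of_le_of_ne (hk ▸ hmono ha.le) fun he => ?_
        have := huniq _ he
        rw [← hk] at this
        exact ha.ne (τ.injective this)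
    rw [this, Finset.card_image_of_injective _ τ.injective, Fin.card_Iio]
  have : (⟨ℓ, h⟩ : Fin n) = k := Fin.ext (by simpa using c1.symm.trans c2)
  rw [this, hk]

/-- The sorting permutation is characterized by finitely many comparisons between the values. -/
theorem measurable_sort {n : ℕ} {α : Type*} [MeasurableSpace α] {g : α → Fin n → ℝ}
    (hg : ∀ j, Measurable fun a => g a j) (τ : Equiv.Perm (Fin n)) :
    MeasurableSet {a | Tuple.sort (g a) = τ} := by
  have : {a | Tuple.sort (g a) = τ} =
      {a | (∀ i j, i ≤ j → g a (τ i) ≤ g a (τ j)) ∧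
        ∀ i j, i < j → g a (τ i) = g a (τ j) → τ i < τ j} := by
    ext a
    simp only [Set.mem_ofPred_eq]
    rw [eq_comm, Tuple.eq_sort_iff]
    rfl
  rw [this, Set.ofPred_and]
  refine MeasurableSet.inter ?_ ?_
  · simp only [Set.ofPred_forall]
    exact MeasurableSet.iInter fun i => MeasurableSet.iInter fun j => MeasurableSet.iInter fun _ =>
      measurableSet_le (hg _) (hg _)
  · simp only [Set.ofPred_forall]
    refine MeasurableSet.iInter fun i => MeasurableSet.iInter fun j => MeasurableSet.iInter fun _ =>
      ?_
    simp only [imp_iff_not_or]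
    exact (measurableSet_eq_fun (hg _) (hg _)).compl.union (MeasurableSet.const _)

/-! ### Joint law of the closest points -/

theorem measurePreserving_comp_embedding_prod_compl {n m : ℕ} {V : Type*} [MeasurableSpace V]
    (ρ : Measure V) [SigmaFinite ρ] (σ : Fin m ↪ Fin n) [DecidablePred (· ∈ Set.range σ)] :
    MeasurePreserving (fun (y : Fin n → V) =>
        ((fun k => y (σ k), fun j => y j) : (Fin m → V) × ({j // j ∉ Set.range σ} → V)))
      (Measure.pi fun _ => ρ) ((Measure.pi fun _ => ρ).prod (Measure.pi fun _ => ρ)) := by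
  have h1 := measurePreserving_piEquivPiSubtypeProd (fun _ : Fin n => ρ) (· ∈ Set.range σ)
  let _ : Fintype {j // j ∈ Set.range σ} := Subtype.fintype _
  have h2 := (measurePreserving_piCongrLeft (fun _ : {j // j ∈ Set.range σ} => ρ)
    (Equiv.ofInjective σ σ.injective)).symm
  exact (h2.prod (MeasurePreserving.id _)).comp h1

/-- Fubini: once the points indexed by `σ` are fixed at `z`, the other `n - m` are independent, and
each satisfies the constraint with the same probability. -/
theorem pi_first_points_apply {n m : ℕ} {V : Type*} [MeasurableSpace V]
    (ρ : Measure V) [SigmaFinite ρ] (σ : Fin m ↪ Fin n) {A : Set (Fin m → V)}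
    (hA : MeasurableSet A) {R : Set ((Fin m → V) × V)} (hR : MeasurableSet R) :
    MeasurableSet {y : Fin n → V | (fun k => y (σ k)) ∈ A ∧
        ∀ j, j ∉ Set.range σ → ((fun k => y (σ k)), y j) ∈ R} ∧
    (Measure.pi fun _ : Fin n => ρ) {y | (fun k => y (σ k)) ∈ A ∧
        ∀ j, j ∉ Set.range σ → ((fun k => y (σ k)), y j) ∈ R} =
      ∫⁻ z in A, (ρ {v | (z, v) ∈ R}) ^ (n - m) ∂(Measure.pi fun _ => ρ) := by
  classical
  have hmp := measurePreserving_comp_embedding_prod_compl ρ σ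
  set S : Set ((Fin m → V) × ({j // j ∉ Set.range σ} → V)) :=
    {p | p.1 ∈ A ∧ ∀ j, (p.1, p.2 j) ∈ R} with hS
  have hSm : MeasurableSet S := by
    refine MeasurableSet.inter (measurable_fst hA) ?_
    change MeasurableSet {p : (Fin m → V) × ({j // j ∉ Set.range σ} → V) |
      ∀ j, (p.1, p.2 j) ∈ R}
    simp only [Set.ofPred_forall]
    refine MeasurableSet.iInter fun j => ?_
    have : Measurable fun p : (Fin m → V) × ({j // j ∉ Set.range σ} → V) => (p.1, p.2 j) :=
      by fun_prop
    exact this hR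
  have hpre : {y : Fin n → V | (fun k => y (σ k)) ∈ A ∧
      ∀ j, j ∉ Set.range σ → ((fun k => y (σ k)), y j) ∈ R} =
      (fun (y : Fin n → V) => (fun k => y (σ k), fun j : {j // j ∉ Set.range σ} => y j)) ⁻¹' S := by
    ext y
    simp only [hS, Set.mem_ofPred_eq, Set.mem_preimage, Subtype.forall]
  rw [hpre]
  refine ⟨hmp.measurable hSm, ?_⟩
  rw [hmp.measure_preimage hSm.nullMeasurableSet, Measure.prod_apply hSm,
    ← lintegral_indicator hA]
  refine lintegral_congr fun z => ?_
  by_cases hz : z ∈ A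
  · have : Prod.mk z ⁻¹' S = Set.univ.pi fun _ => {v | (z, v) ∈ R} := by
      ext u
      simp [hS, hz]
    rw [this, Measure.pi_pi, Set.indicator_of_mem hz, Finset.prod_const, Finset.card_univ]
    congr 1
    have h1 := Fintype.card_subtype_compl (fun j => j ∈ Set.range σ)
    have h2 : Fintype.card {j // j ∈ Set.range σ} = m := by
      rw [← Fintype.card_congr (Equiv.ofInjective σ σ.injective), Fintype.card_fin]
    rw [h2, Fintype.card_fin] at h1
    rw [← h1]
  · have : Prod.mk z ⁻¹' S = ∅ := by
      ext u
      simp [hS, hz]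
    rw [this, measure_empty, Set.indicator_of_notMem hz]

/-- The `m` points of smallest norm of a sample of `n` i.i.d. points: a lower bound for their joint
law. The map `T` is any choice of the `m` closest points. -/
theorem lintegral_le_map_closest {n m : ℕ} {V : Type*} [NormedAddCommGroup V] [MeasurableSpace V]
    [BorelSpace V] [SecondCountableTopology V]
    (ρ : Measure V) [SigmaFinite ρ] {T : (Fin n → V) → Fin m → V} (hT : Measurable T)
    (hTσ : ∀ (σ : Fin m ↪ Fin n) (y : Fin n → V), StrictMono (fun k => ‖y (σ k)‖) →
      (∀ j, j ∉ Set.range σ → ∀ k, ‖y (σ k)‖ < ‖y j‖) → T y = fun k => y (σ k))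
    {A : Set (Fin m → V)} (hA : MeasurableSet A) (hAmono : ∀ z ∈ A, StrictMono fun k => ‖z k‖) :
    (n.descFactorial m : ℝ≥0∞) *
        ∫⁻ z in A, (ρ (Metric.closedBall 0 ‖z‖)ᶜ) ^ (n - m) ∂(Measure.pi fun _ => ρ) ≤
      (Measure.pi fun _ : Fin n => ρ).map T A := by
  -- The norm of a tuple is the maximum of its norms, so `R` says that a point is farther out than
  -- all the chosen ones.
  set R : Set ((Fin m → V) × V) := {p | ‖p.1‖ < ‖p.2‖} with hRdef
  have hR : MeasurableSet R := measurableSet_lt (by fun_prop) (by fun_prop)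
  have hcl : ∀ z : Fin m → V, {v | (z, v) ∈ R} = (Metric.closedBall (0 : V) ‖z‖)ᶜ := by
    intro z; ext v; simp [hRdef]
  set ev : (Fin m ↪ Fin n) → Set (Fin n → V) := fun σ => {y | (fun k => y (σ k)) ∈ A ∧
        ∀ j, j ∉ Set.range σ → ((fun k => y (σ k)), y j) ∈ R} with hev
  have hfar : ∀ σ, ∀ y ∈ ev σ, ∀ j, j ∉ Set.range σ → ∀ k, ‖y (σ k)‖ < ‖y j‖ := by
    intro σ y hy j hj k
    exact (norm_le_pi_norm (fun k => y (σ k)) k).trans_lt (hy.2 j hj)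
  have hT' : ∀ σ, ev σ ⊆ T ⁻¹' A := by
    intro σ y hy
    rw [Set.mem_preimage, hTσ σ y (hAmono _ hy.1) (hfar σ y hy)]
    exact hy.1
  -- On `ev σ` the sorting permutation starts with `σ`, so a sample determines `σ`.
  have hdisj : Pairwise (Function.onFun Disjoint ev) := by
    intro σ τ hne
    refine Set.disjoint_left.2 fun y hσ hτ => hne ?_
    ext k
    have hn : (k : ℕ) < n := by
      have := Fintype.card_le_of_embedding σ
      simp only [Fintype.card_fin] at this
      omega
    have e1 := sort_eq_of_strictMono (fun j => ‖y j‖) σ (hAmono _ hσ.1) (hfar σ y hσ) k hn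
    have e2 := sort_eq_of_strictMono (fun j => ‖y j‖) τ (hAmono _ hτ.1) (hfar τ y hτ) k hn
    rw [← e1, ← e2]
  have hmeas : ∀ σ, MeasurableSet (ev σ) := fun σ => (pi_first_points_apply ρ σ hA hR).1
  rw [Measure.map_apply hT hA]
  refine le_trans (le_of_eq ?_) (measure_mono (Set.iUnion_subset hT'))
  rw [measure_iUnion hdisj hmeas, tsum_fintype]
  simp_rw [hev, fun σ => (pi_first_points_apply ρ σ hA hR).2, hcl]
  -- All events have the same probability; the falling factorial counts the embeddings.
  rw [Finset.sum_const, Finset.card_univ, Fintype.card_embedding_eq, Fintype.card_fin,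
    Fintype.card_fin, nsmul_eq_mul]

/-! ### Polar coordinates -/

/-- Lebesgue measure on `ℝ^d`, normalized to give mass `1` to the unit ball. -/
noncomputable def ballVolume (d : ℕ) : Measure (EuclideanSpace ℝ (Fin d)) :=
  (volume (Metric.ball (0 : EuclideanSpace ℝ (Fin d)) 1))⁻¹ • volume

instance (d : ℕ) : SigmaFinite (ballVolume d) := by
  have hc : (volume (Metric.ball (0 : EuclideanSpace ℝ (Fin d)) 1))⁻¹ ≠ ∞ :=
    ENNReal.inv_ne_top.2 (Metric.measure_ball_pos volume _ one_pos).ne'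
  rw [ballVolume, ← ENNReal.coe_toNNReal hc]
  exact inferInstanceAs (SigmaFinite (ENNReal.toNNReal _ • volume))

/-- Substitution `s = r ^ d`, with Jacobian `d * r ^ (d - 1)`. -/
theorem map_rpow_restrict_Ioi {d : ℕ} (hd : 0 < d) :
    ((volume : Measure ℝ).restrict (Set.Ioi 0)).map (fun s => s ^ (1 / (d : ℝ))) =
      (d : ℝ≥0∞) • ((volume : Measure ℝ).restrict (Set.Ioi 0)).withDensity
        fun r => ENNReal.ofReal (r ^ (d - 1)) := by
  have hm : Measurable fun s : ℝ => s ^ (1 / (d : ℝ)) := by fun_prop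
  have hd' : (d : ℝ) ≠ 0 := by positivity
  ext B hB
  rw [Measure.map_apply hm hB, Measure.restrict_apply (hm hB), Measure.smul_apply,
    withDensity_apply _ hB, Measure.restrict_restrict hB, smul_eq_mul]
  have hset : (fun s : ℝ => s ^ (1 / (d : ℝ))) ⁻¹' B ∩ Set.Ioi 0 =
      (fun r : ℝ => r ^ d) '' (B ∩ Set.Ioi 0) := by
    ext s
    constructor
    · rintro ⟨h1, h2 : 0 < s⟩
      refine ⟨s ^ (1 / (d : ℝ)), ⟨h1, Real.rpow_pos_of_pos h2 _⟩, ?_⟩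
      simp only
      rw [← Real.rpow_natCast, ← Real.rpow_mul h2.le, one_div_mul_cancel hd', Real.rpow_one]
    · rintro ⟨r, ⟨h1, h2 : 0 < r⟩, rfl⟩
      refine ⟨?_, pow_pos h2 d⟩
      simp only [Set.mem_preimage]
      rwa [← Real.rpow_natCast, ← Real.rpow_mul h2.le, mul_one_div_cancel hd', Real.rpow_one]
  have hinj : Set.InjOn (fun r : ℝ => r ^ d) (B ∩ Set.Ioi 0) := fun a ha b hb hab =>
    (pow_left_inj₀ (le_of_lt ha.2) (le_of_lt hb.2) hd.ne').1 hab
  have hcv := lintegral_image_eq_lintegral_abs_deriv_mul (f := fun r : ℝ => r ^ d)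
    (f' := fun r => d * r ^ (d - 1)) (hB.inter measurableSet_Ioi)
    (fun r _ => (hasDerivAt_pow d r).hasDerivWithinAt) hinj 1
  simp only [Pi.one_apply, lintegral_one, mul_one, Measure.restrict_apply_univ] at hcv
  rw [hset, hcv, ← lintegral_const_mul _ (by fun_prop)]
  refine setLIntegral_congr_fun (hB.inter measurableSet_Ioi) fun r hr => ?_
  have hr0 : (0 : ℝ) < r := hr.2
  rw [abs_of_nonneg (by positivity), ENNReal.ofReal_mul (by positivity), ENNReal.ofReal_natCast]

/-- Polar coordinates: if the direction is uniform and the `d`-th power of the radius is Lebesgue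
distributed, then the point is distributed as normalized Lebesgue measure. -/
theorem map_polar_uniformSphere {d : ℕ} (hd : 0 < d) :
    (((volume : Measure ℝ).restrict (Set.Ioi 0)).prod (uniformSphere d)).map
      (fun p => p.1 ^ (1 / (d : ℝ)) • (p.2 : EuclideanSpace ℝ (Fin d))) = ballVolume d := by
  have : Nonempty (Fin d) := ⟨⟨0, hd⟩⟩
  set V := EuclideanSpace ℝ (Fin d)
  set τ := (volume : Measure V).toSphere with hτ
  have hfr : Module.finrank ℝ V = d := by simp [V]
  set w := ((volume : Measure ℝ).restrict (Set.Ioi 0)).withDensity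
    fun r => ENNReal.ofReal (r ^ (d - 1)) with hw
  have hw' : (Measure.volumeIoiPow (d - 1)).map Subtype.val = w := by
    rw [Measure.volumeIoiPow, map_withDensity_comp _ measurable_subtype_coe
      (g := fun r => ENNReal.ofReal (r ^ (d - 1))) (by fun_prop),
      map_comap_subtype_coe measurableSet_Ioi]
  have hsm : Measurable fun p : Metric.sphere (0 : V) 1 × ℝ => p.2 • (p.1 : V) := by fun_prop
  have hvol : (τ.prod w).map (fun p => p.2 • (p.1 : V)) = volume := by
    have hmp := (volume : Measure V).measurePreserving_homeomorphUnitSphereProd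
    rw [hfr] at hmp
    have hmp' := hmp.symm (homeomorphUnitSphereProd V).toMeasurableEquiv
    -- Polar coordinates omit the origin, a null set.
    have h1 : (volume : Measure V) = ((volume : Measure V).comap
        (Subtype.val : ({0}ᶜ : Set V) → V)).map Subtype.val := by
      rw [map_comap_subtype_coe (measurableSet_singleton 0).compl, restrict_compl_singleton]
    have hid : τ.prod w = (τ.prod (Measure.volumeIoiPow (d - 1))).map
        (Prod.map id Subtype.val) := by
      rw [← hw', ← Measure.map_prod_map _ _ measurable_id measurable_subtype_coe, Measure.map_id]
    rw [h1, ← hmp'.map_eq, hid, Measure.map_map hsm (by fun_prop),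
      Measure.map_map measurable_subtype_coe hmp'.measurable]
    rfl
  have hcd : (volume : Measure V) (Metric.ball 0 1) ≠ 0 :=
    (Metric.measure_ball_pos volume _ one_pos).ne'
  have hcd' : (volume : Measure V) (Metric.ball 0 1) ≠ ∞ := measure_ball_lt_top.ne
  have hswap : (((volume : Measure ℝ).restrict (Set.Ioi 0)).prod (uniformSphere d)).map
      (fun p => p.1 ^ (1 / (d : ℝ)) • (p.2 : V)) =
      ((uniformSphere d).prod (((volume : Measure ℝ).restrict (Set.Ioi 0)).map
        (fun s => s ^ (1 / (d : ℝ))))).map (fun p => p.2 • (p.1 : V)) := by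
    have hf : SFinite (uniformSphere d) := by
      unfold uniformSphere; infer_instance
    have hid : (uniformSphere d).prod (((volume : Measure ℝ).restrict (Set.Ioi 0)).map
        (fun s => s ^ (1 / (d : ℝ)))) =
        ((uniformSphere d).prod ((volume : Measure ℝ).restrict (Set.Ioi 0))).map
          (Prod.map id fun s => s ^ (1 / (d : ℝ))) := by
      rw [← Measure.map_prod_map _ _ measurable_id (by fun_prop), Measure.map_id]
    rw [hid, ← Measure.prod_swap, Measure.map_map (by fun_prop) measurable_swap,
      Measure.map_map hsm (by fun_prop)]
    rfl
  rw [hswap, map_rpow_restrict_Ioi hd, ← hw, uniformSphere, ← hτ, Measure.prod_smul_right,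
    Measure.prod_smul_left, Measure.map_smul, Measure.map_smul, hvol, ballVolume, smul_smul,
    hτ, Measure.toSphere_apply_univ, hfr]
  congr 1
  -- The sphere has surface mass `d` times the volume of the ball; this `d` cancels the one in the
  -- Jacobian.
  have hd0 : (d : ℝ≥0∞) ≠ 0 := by exact_mod_cast hd.ne'
  rw [ENNReal.mul_inv (Or.inl hd0) (Or.inl (ENNReal.natCast_ne_top d)), ← mul_assoc,
    ENNReal.mul_inv_cancel hd0 (ENNReal.natCast_ne_top d), one_mul]

theorem map_polar_uniformSphere_pi {d : ℕ} (hd : 0 < d) (m : ℕ) :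
    ((Measure.pi fun _ : Fin m => (volume : Measure ℝ).restrict (Set.Ici 0)).prod
      (Measure.pi fun _ : Fin m => uniformSphere d)).map
      (fun p ℓ => p.1 ℓ ^ (1 / (d : ℝ)) • (p.2 ℓ : EuclideanSpace ℝ (Fin d))) =
    Measure.pi fun _ => ballVolume d := by
  have hf : IsFiniteMeasure (uniformSphere d) := by
    have : Nonempty (Fin d) := ⟨⟨0, hd⟩⟩
    refine ⟨?_⟩
    unfold uniformSphere
    refine ENNReal.mul_lt_top ?_ (measure_lt_top _ _)
    rw [ENNReal.inv_lt_top, Measure.measure_univ_pos]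
    exact Measure.toSphere_ne_zero _
  have h1 := measurePreserving_arrowProdEquivProdArrow ℝ
    (Metric.sphere (0 : EuclideanSpace ℝ (Fin d)) 1) (Fin m)
    (fun _ => (volume : Measure ℝ).restrict (Set.Ici 0)) (fun _ => uniformSphere d)
  have h2 := map_polar_uniformSphere hd
  rw [Measure.restrict_congr_set Ioi_ae_eq_Ici] at h2
  have hm : Measurable fun p : ℝ × Metric.sphere (0 : EuclideanSpace ℝ (Fin d)) 1 =>
    p.1 ^ (1 / (d : ℝ)) • (p.2 : EuclideanSpace ℝ (Fin d)) := by fun_prop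
  have hsf : SigmaFinite ((((volume : Measure ℝ).restrict (Set.Ici 0)).prod (uniformSphere d)).map
      (fun p => p.1 ^ (1 / (d : ℝ)) • (p.2 : EuclideanSpace ℝ (Fin d)))) := by
    rw [h2]; infer_instance
  rw [← h1.map_eq, Measure.map_map (by fun_prop) h1.measurable, ← h2,
    ← Measure.pi_map_pi fun _ => hm.aemeasurable]
  rfl

/-! ### Density bound for the limit law -/

/-- The partial sums of a finite sequence. -/
noncomputable def partialSums {m : ℕ} (e : Fin m → ℝ) (ℓ : Fin m) : ℝ := ∑ j ∈ Finset.Iic ℓ, e j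

theorem measurable_partialSums {m : ℕ} : Measurable (partialSums (m := m)) := by
  unfold partialSums; fun_prop

/-- The matrix of partial sums is lower triangular with unit diagonal, hence has determinant 1. -/
theorem map_partialSums_volume (m : ℕ) :
    (volume : Measure (Fin m → ℝ)).map partialSums = volume := by
  set M : Matrix (Fin m) (Fin m) ℝ := Matrix.of fun ℓ j => if j ≤ ℓ then 1 else 0 with hM
  have hdet : M.det = 1 := by
    rw [Matrix.det_of_isLowerTriangular]
    · simp [hM]
    · intro i j hij
      have : i < j := by simpa using hij
      simp [hM, this]
  have := Real.map_matrix_volume_pi_eq_smul_volume_pi (M := M) (by simp [hdet])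
  rw [hdet] at this
  simp only [inv_one, abs_one, ENNReal.ofReal_one, one_smul] at this
  convert this using 2
  ext e ℓ
  simp only [partialSums, hM, Matrix.toLin'_apply, Matrix.mulVec, dotProduct, Matrix.of_apply,
    ite_mul, one_mul, zero_mul]
  rw [← Finset.sum_filter]
  congr 1
  ext j
  simp

/-- The joint density `exp (-∑ e_j)` is `exp` of minus the last, hence largest, partial sum. The
right side drops the constraint that partial sums increase, which leaves an inequality. -/
theorem map_partialSums_expMeasure_le (m : ℕ) :
    (Measure.pi fun _ : Fin m => expMeasure 1).map partialSums ≤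
      (Measure.pi fun _ : Fin m => (volume : Measure ℝ).restrict (Set.Ici 0)).withDensity
        fun s => ENNReal.ofReal (Real.exp (-‖s‖)) := by
  have hprob := isProbabilityMeasure_expMeasure one_pos
  have hexp : expMeasure 1 = volume.withDensity (exponentialPDF 1) := rfl
  have hmeas : Measurable (exponentialPDF 1) :=
    (measurable_exponentialPDFReal 1).ennreal_ofReal
  have hsf : SigmaFinite (volume.withDensity (exponentialPDF 1)) := by
    rw [← hexp]; infer_instance
  set P : Set (Fin m → ℝ) := Set.univ.pi fun _ => Set.Ici 0 with hP
  have hPm : MeasurableSet P := MeasurableSet.univ_pi fun _ => measurableSet_Ici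
  have hK : Measurable fun s : Fin m → ℝ => ENNReal.ofReal (Real.exp (-‖s‖)) := by fun_prop
  rw [← Measure.restrict_pi_pi, ← hP, ← withDensity_indicator hPm, hexp,
    pi_withDensity _ _ hmeas, ← volume_pi]
  nth_rw 2 [← map_partialSums_volume m]
  rw [← map_withDensity_comp _ measurable_partialSums (hK.indicator hPm)]
  refine Measure.map_mono (withDensity_mono (ae_of_all _ fun e => ?_)) measurable_partialSums
  by_cases he : ∀ i, 0 ≤ e i
  · have hmem : partialSums e ∈ P := fun ℓ _ => Finset.sum_nonneg fun j _ => he j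
    simp only
    rw [Set.indicator_of_mem hmem]
    simp only [fun i => exponentialPDF_of_nonneg (r := 1) (he i), one_mul]
    rw [← ENNReal.ofReal_prod_of_nonneg fun _ _ => (Real.exp_pos _).le, ← Real.exp_sum,
      Finset.sum_neg_distrib]
    refine ENNReal.ofReal_le_ofReal (Real.exp_le_exp.2 (neg_le_neg ?_))
    refine (pi_norm_le_iff_of_nonneg (Finset.sum_nonneg fun j _ => he j)).2 fun ℓ => ?_
    rw [Real.norm_of_nonneg (hmem ℓ trivial)]
    exact Finset.sum_le_sum_of_subset_of_nonneg (Finset.subset_univ _) fun j _ _ => he j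
  · push Not at he
    obtain ⟨i, hi⟩ := he
    have : ∏ i, exponentialPDF 1 (e i) = 0 :=
      Finset.prod_eq_zero (Finset.mem_univ i) (exponentialPDF_of_neg hi)
    simp [this]

/-- The joint law of the points with radii `(E₁ + ⋯ + E_ℓ)^{1/d}` and uniform directions is at most
the measure with density `exp (-‖z‖^d)`. -/
theorem map_poisson_points_le {d : ℕ} (hd : 0 < d) (m : ℕ) [IsProbabilityMeasure (uniformSphere d)] :
    ((Measure.pi fun _ : Fin m => expMeasure 1).prod
      (Measure.pi fun _ : Fin m => uniformSphere d)).map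
      (fun p ℓ => partialSums p.1 ℓ ^ (1 / (d : ℝ)) • (p.2 ℓ : EuclideanSpace ℝ (Fin d))) ≤
    (Measure.pi fun _ => ballVolume d).withDensity
      fun z => ENNReal.ofReal (Real.exp (-‖z‖ ^ d)) := by
  have hprob := isProbabilityMeasure_expMeasure one_pos
  have hd' : (d : ℝ) ≠ 0 := by positivity
  set G : (Fin m → ℝ) × (Fin m → Metric.sphere (0 : EuclideanSpace ℝ (Fin d)) 1) →
    Fin m → EuclideanSpace ℝ (Fin d) :=
      fun p ℓ => p.1 ℓ ^ (1 / (d : ℝ)) • (p.2 ℓ : EuclideanSpace ℝ (Fin d)) with hG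
  have hGm : Measurable G := by fun_prop
  have hK : Measurable fun z : Fin m → EuclideanSpace ℝ (Fin d) =>
    ENNReal.ofReal (Real.exp (-‖z‖ ^ d)) := by fun_prop
  have hS := measurable_partialSums (m := m)
  have h1 : ((Measure.pi fun _ : Fin m => expMeasure 1).prod
      (Measure.pi fun _ : Fin m => uniformSphere d)).map
      (fun p ℓ => partialSums p.1 ℓ ^ (1 / (d : ℝ)) • (p.2 ℓ : EuclideanSpace ℝ (Fin d))) =
      (((Measure.pi fun _ : Fin m => expMeasure 1).map partialSums).prod
        (Measure.pi fun _ : Fin m => uniformSphere d)).map G := by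
    have hid := Measure.map_prod_map (Measure.pi fun _ : Fin m => expMeasure 1)
      (Measure.pi fun _ : Fin m => uniformSphere d) hS measurable_id
    rw [Measure.map_id] at hid
    rw [hid, Measure.map_map hGm (hS.prodMap measurable_id)]
    rfl
  rw [h1]
  refine (Measure.map_mono (Measure.prod_mono (map_partialSums_expMeasure_le m) le_rfl) hGm).trans
    ?_
  rw [prod_withDensity_left (by fun_prop), ← map_polar_uniformSphere_pi hd m,
    ← map_withDensity_comp _ hGm hK]
  refine Measure.map_mono (withDensity_mono (ae_of_all _ fun p => ?_)) hGm
  refine ENNReal.ofReal_le_ofReal (Real.exp_le_exp.2 (neg_le_neg ?_))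
  have hle : ‖G p‖ ≤ ‖p.1‖ ^ (1 / (d : ℝ)) := by
    refine (pi_norm_le_iff_of_nonneg (by positivity)).2 fun ℓ => ?_
    simp only [hG, norm_smul, norm_eq_of_mem_sphere, mul_one, Real.norm_eq_abs]
    refine (Real.abs_rpow_le_abs_rpow _ _).trans ?_
    exact Real.rpow_le_rpow (abs_nonneg _) (norm_le_pi_norm p.1 ℓ) (by positivity)
  calc ‖G p‖ ^ d ≤ (‖p.1‖ ^ (1 / (d : ℝ))) ^ d := by gcongr
    _ = ‖p.1‖ := by
      rw [← Real.rpow_natCast, ← Real.rpow_mul (norm_nonneg _), one_div_mul_cancel hd',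
        Real.rpow_one]

theorem measurable_exponentialPDF (r : ℝ) : Measurable (exponentialPDF r) :=
  (measurable_exponentialPDFReal r).ennreal_ofReal

/-- The mean is 1 because `x * exp (-x)` is the Gamma density with shape 2 and rate 1. -/
theorem lintegral_ofReal_expMeasure : ∫⁻ x, ENNReal.ofReal x ∂expMeasure 1 = 1 := by
  have hexp : expMeasure 1 = volume.withDensity (exponentialPDF 1) := rfl
  rw [hexp, lintegral_withDensity_eq_lintegral_mul _
    (measurable_exponentialPDF 1) (by fun_prop),
    ← lintegral_gammaPDF_eq_one (a := 2) (r := 1) two_pos one_pos]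
  refine lintegral_congr fun x => ?_
  rcases lt_or_ge x 0 with hx | hx
  · simp [exponentialPDF_of_neg hx, gammaPDF_of_neg hx]
  · rw [Pi.mul_apply, exponentialPDF_of_nonneg hx, gammaPDF_of_nonneg hx,
      ← ENNReal.ofReal_mul (by positivity)]
    congr 1
    norm_num
    ring

theorem expMeasure_ae_pos : ∀ᵐ x ∂expMeasure 1, 0 < x := by
  have hexp : expMeasure 1 = volume.withDensity (exponentialPDF 1) := rfl
  rw [hexp, ae_withDensity_iff (measurable_exponentialPDF 1)]
  filter_upwards [Measure.ae_ne volume (0 : ℝ)] with x hx h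
  by_contra hcon
  exact h (exponentialPDF_of_neg (lt_of_le_of_ne (not_lt.1 hcon) hx))

/-! ### Conditional law of the sample -/

theorem measurable_update_prod {ι V : Type*} [DecidableEq ι] [MeasurableSpace V] (k : ι) :
    Measurable fun p : V × (ι → V) => Function.update p.2 k p.1 := by
  refine measurable_pi_lambda _ fun j => ?_
  by_cases hj : j = k
  · subst hj
    simpa using measurable_fst
  · simp only [Function.update_of_ne hj]
    fun_prop

/-- Resampling one coordinate of an i.i.d. sample does not change its law. -/
theorem map_update_prod_pi {n : ℕ} {V : Type*} [MeasurableSpace V] (ρ : Measure V)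
    [IsProbabilityMeasure ρ] (k : Fin n) :
    (ρ.prod (Measure.pi fun _ : Fin n => ρ)).map (fun p => Function.update p.2 k p.1) =
      Measure.pi fun _ => ρ := by
  refine (Measure.pi_eq fun s hs => ?_).symm
  rw [Measure.map_apply (measurable_update_prod k) (MeasurableSet.univ_pi hs)]
  -- The overwritten coordinate is unconstrained, hence `Set.univ` in place `k`.
  have : (fun p : V × (Fin n → V) => Function.update p.2 k p.1) ⁻¹' Set.univ.pi s =
      s k ×ˢ Set.univ.pi (Function.update s k Set.univ) := by
    ext p
    simp only [Set.mem_preimage, Set.mem_univ_pi, Set.mem_prod]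
    constructor
    · intro h
      refine ⟨by simpa using h k, fun j => ?_⟩
      by_cases hj : j = k
      · subst hj; simp
      · simpa [Function.update_of_ne hj] using h j
    · rintro ⟨h1, h2⟩ j
      by_cases hj : j = k
      · subst hj; simpa using h1
      · simpa [Function.update_of_ne hj] using h2 j
  rw [this, Measure.prod_prod, Measure.pi_pi, ← Finset.mul_prod_erase _ _ (Finset.mem_univ k),
    ← Finset.mul_prod_erase Finset.univ (fun i => ρ (s i)) (Finset.mem_univ k)]
  simp only [Function.update_self, measure_univ, one_mul]
  congr 1
  refine Finset.prod_congr rfl fun j hj => ?_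
  rw [Function.update_of_ne (Finset.ne_of_mem_erase hj)]

/-- Conditional distributions are almost surely unique, so it is enough that the kernel `z ↦
condSampleLaw ρ k z` reproduces the joint law of `X k` and the sample. This is the invariance under
resampling coordinate `k`. -/
theorem condDistrib_sample_ae_eq {d : ℕ} {Ω : Type*} [MeasurableSpace Ω] (P : Measure Ω)
    [IsProbabilityMeasure P] (X : ℕ → Ω → EuclideanSpace ℝ (Fin d))
    (ρ : Measure (EuclideanSpace ℝ (Fin d)))
    (hX_law : ∀ j, HasLaw (X j) ρ P) (hX_indep : iIndepFun X P)
    (n : ℕ) (k : Fin (n + 1)) :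
    ∀ᵐ z ∂(P.map (X k)), condDistrib (fun ω (j : Fin (n + 1)) => X j ω) (X k) P z =
      condSampleLaw ρ k z := by
  have hρ : IsProbabilityMeasure ρ := (hX_law 0).isProbabilityMeasure_iff.1 inferInstance
  set π := Measure.pi fun _ : Fin (n + 1) => ρ with hπ
  have hY : HasLaw (fun ω (j : Fin (n + 1)) => X j ω) π P :=
    (hX_indep.precomp (g := fun j : Fin (n + 1) => (j : ℕ)) Fin.val_injective).hasLaw_pi
      fun j => hX_law j
  have hu := measurable_update_prod (V := EuclideanSpace ℝ (Fin d)) k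
  set κ : Kernel (EuclideanSpace ℝ (Fin d)) (Fin (n + 1) → EuclideanSpace ℝ (Fin d)) :=
    (Kernel.id ×ₖ Kernel.const _ π).map fun p => Function.update p.2 k p.1 with hκ
  have hκz : ∀ z, κ z = condSampleLaw ρ k z := by
    intro z
    rw [hκ, Kernel.map_apply _ hu, Kernel.prod_apply, Kernel.id_apply, Kernel.const_apply,
      Measure.dirac_prod, Measure.map_map hu (by fun_prop)]
    rfl
  have : IsMarkovKernel κ := Kernel.IsMarkovKernel.map _ hu
  have h := condDistrib_ae_eq_of_measure_eq_compProd (μ := P) (X k) (κ := κ) hY.aemeasurable ?_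
  · filter_upwards [h] with z hz
    rw [hz, hκz]
  · have hk : Measurable fun y : Fin (n + 1) → EuclideanSpace ℝ (Fin d) => (y k, y) := by fun_prop
    have e1 : P.map (fun ω => (X k ω, fun j : Fin (n + 1) => X j ω)) =
        π.map fun y => (y k, y) := by
      rw [← hY.map_eq, AEMeasurable.map_map_of_aemeasurable hk.aemeasurable hY.aemeasurable]
      rfl
    rw [e1, (hX_law k).map_eq, hπ, ← map_update_prod_pi ρ k, Measure.map_map hk hu, ← hπ]
    ext A hA
    rw [Measure.map_apply (hk.comp hu) hA, Measure.prod_apply ((hk.comp hu) hA),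
      Measure.compProd_apply hA]
    refine lintegral_congr fun z => ?_
    have huz : Measurable fun y : Fin (n + 1) → EuclideanSpace ℝ (Fin d) =>
        Function.update y k z := hu.comp measurable_prodMk_left
    rw [hκz, condSampleLaw, Measure.map_apply huz (measurable_prodMk_left hA)]
    congr 1
    ext y
    simp

/-! ### Nearest-neighbour vectors as closest points -/

/-- The vectors to the nearest neighbours of `x` within the sample `y`, scaled by `a`. -/
noncomputable def closestVectors {d n : ℕ} (x : EuclideanSpace ℝ (Fin d)) (a : ℝ) (m : ℕ)
    (y : Fin n → EuclideanSpace ℝ (Fin d)) (ℓ : Fin m) : EuclideanSpace ℝ (Fin d) :=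
  if h : (ℓ : ℕ) < n then a • (y (Tuple.sort (fun j => ‖y j - x‖) ⟨ℓ, h⟩) - x) else 0

theorem measurable_closestVectors {d n : ℕ} (a : ℝ) (m : ℕ) :
    Measurable fun p : EuclideanSpace ℝ (Fin d) × (Fin n → EuclideanSpace ℝ (Fin d)) =>
      closestVectors p.1 a m p.2 := by
  refine measurable_pi_lambda _ fun ℓ => ?_
  by_cases h : (ℓ : ℕ) < n
  -- On each of the finitely many pieces where the sorting permutation is constant, the map is
  -- affine in the data.
  · have hpiece : ∀ τ : Equiv.Perm (Fin n), MeasurableSet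
        {p : EuclideanSpace ℝ (Fin d) × (Fin n → EuclideanSpace ℝ (Fin d)) |
          Tuple.sort (fun j => ‖p.2 j - p.1‖) = τ} := fun τ =>
      measurable_sort (fun j => by fun_prop) τ
    have hev : ∀ τ : Equiv.Perm (Fin n), Measurable
        fun p : EuclideanSpace ℝ (Fin d) × (Fin n → EuclideanSpace ℝ (Fin d)) =>
          a • (p.2 (τ ⟨ℓ, h⟩) - p.1) := fun τ => by fun_prop
    intro B hB
    have : (fun p : EuclideanSpace ℝ (Fin d) × (Fin n → EuclideanSpace ℝ (Fin d)) =>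
        closestVectors p.1 a m p.2 ℓ) ⁻¹' B =
        ⋃ τ : Equiv.Perm (Fin n), {p | Tuple.sort (fun j => ‖p.2 j - p.1‖) = τ} ∩
          (fun p : EuclideanSpace ℝ (Fin d) × (Fin n → EuclideanSpace ℝ (Fin d)) =>
            a • (p.2 (τ ⟨ℓ, h⟩) - p.1)) ⁻¹' B := by
      ext p
      simp [closestVectors, h]
    rw [this]
    exact MeasurableSet.iUnion fun τ => (hpiece τ).inter (hev τ hB)
  · simp only [closestVectors, dif_neg h]
    exact measurable_const

/-- Deleting the coordinate frozen at `x` leaves `n` i.i.d. points, and the neighbours are the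
closest of these to `x`. -/
theorem map_nnVector_condSampleLaw {d n : ℕ} (ρ : Measure (EuclideanSpace ℝ (Fin d)))
    [IsProbabilityMeasure ρ] (i : Fin (n + 1)) (x : EuclideanSpace ℝ (Fin d)) (a : ℝ) (m : ℕ) :
    (condSampleLaw ρ i x).map (fun y (ℓ : Fin m) => a • nnVector y i ℓ) =
      (Measure.pi fun _ : Fin n => ρ).map (closestVectors x a m) := by
  have hnn : (fun (y : Fin (n + 1) → EuclideanSpace ℝ (Fin d)) (ℓ : Fin m) =>
      a • nnVector y i ℓ) =
      fun y => closestVectors (y i) a m fun j => y (i.succAbove j) := by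
    ext1 y
    ext1 ℓ
    by_cases h : (ℓ : ℕ) < n <;> simp [nnVector, closestVectors, h]
  have hpt : ∀ y : Fin (n + 1) → EuclideanSpace ℝ (Fin d),
      (fun (ℓ : Fin m) => a • nnVector (Function.update y i x) i ℓ) =
        closestVectors x a m fun j => y (i.succAbove j) := by
    intro y
    have := congrFun hnn (Function.update y i x)
    simpa [Function.update_of_ne (Fin.succAbove_ne i _)] using this
  have hmp := (measurePreserving_snd (μ := ρ) (ν := Measure.pi fun _ : Fin n => ρ)).comp
    (measurePreserving_piFinSuccAbove (fun _ : Fin (n + 1) => ρ) i)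
  have hup : Measurable fun y : Fin (n + 1) → EuclideanSpace ℝ (Fin d) => Function.update y i x :=
    (measurable_update_prod i).comp measurable_prodMk_left
  have hcv : Measurable (closestVectors (n := n) x a m) :=
    (measurable_closestVectors a m).comp measurable_prodMk_left
  have hmeas : Measurable (fun (y : Fin (n + 1) → EuclideanSpace ℝ (Fin d)) (ℓ : Fin m) =>
      a • nnVector y i ℓ) := by
    rw [hnn]
    have hg : Measurable fun y : Fin (n + 1) → EuclideanSpace ℝ (Fin d) =>
        (y i, fun j => y (i.succAbove j)) := by fun_prop
    exact (measurable_closestVectors a m).comp hg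
  rw [condSampleLaw, Measure.map_map hmeas hup, ← hmp.map_eq, Measure.map_map hcv hmp.measurable]
  congr 1
  ext1 y
  exact hpt y

theorem closestVectors_eq_of_strictMono {d n m : ℕ} (x : EuclideanSpace ℝ (Fin d)) {a : ℝ}
    (ha : 0 < a) (σ : Fin m ↪ Fin n) (y : Fin n → EuclideanSpace ℝ (Fin d))
    (hσ : StrictMono fun k => ‖a • (y (σ k) - x)‖)
    (hfar : ∀ j, j ∉ Set.range σ → ∀ k, ‖a • (y (σ k) - x)‖ < ‖a • (y j - x)‖) :
    closestVectors x a m y = fun k => a • (y (σ k) - x) := by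
  have hlt : ∀ u v : EuclideanSpace ℝ (Fin d), ‖a • u‖ < ‖a • v‖ ↔ ‖u‖ < ‖v‖ := fun u v => by
    rw [norm_smul, norm_smul, mul_lt_mul_iff_right₀ (norm_pos_iff.2 ha.ne')]
  ext1 k
  have hn : (k : ℕ) < n := by
    have := Fintype.card_le_of_embedding σ
    simp only [Fintype.card_fin] at this
    omega
  rw [closestVectors, dif_pos hn, sort_eq_of_strictMono (fun j => ‖y j - x‖) σ
    (fun k l hkl => (hlt _ _).1 (hσ hkl)) (fun j hj k => (hlt _ _).1 (hfar j hj k)) k hn]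

/-- A lower bound for the joint law of the scaled vectors to the nearest neighbours. -/
theorem lintegral_le_map_closestVectors {d n m : ℕ} (ρ : Measure (EuclideanSpace ℝ (Fin d)))
    [IsProbabilityMeasure ρ] (x : EuclideanSpace ℝ (Fin d)) {a : ℝ} (ha : 0 < a)
    (ρ' : Measure (EuclideanSpace ℝ (Fin d))) (hρ' : ρ.map (fun y => a • (y - x)) = ρ')
    {A : Set (Fin m → EuclideanSpace ℝ (Fin d))} (hA : MeasurableSet A)
    (hAmono : ∀ z ∈ A, StrictMono fun k => ‖z k‖) :
    (n.descFactorial m : ℝ≥0∞) *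
        ∫⁻ z in A, (ρ' (Metric.closedBall 0 ‖z‖)ᶜ) ^ (n - m) ∂(Measure.pi fun _ => ρ') ≤
      (Measure.pi fun _ : Fin n => ρ).map (closestVectors x a m) A := by
  have hTm : Measurable fun y : EuclideanSpace ℝ (Fin d) => a • (y - x) := by fun_prop
  have hprob : IsProbabilityMeasure ρ' := hρ' ▸ Measure.isProbabilityMeasure_map hTm.aemeasurable
  have hinv : ∀ y, x + a⁻¹ • (a • (y - x)) = y := fun y => by
    rw [smul_smul, inv_mul_cancel₀ ha.ne', one_smul, add_sub_cancel]
  -- Conjugation by `y ↦ a • (y - x)` turns distances to `x` into norms, so that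
  -- `lintegral_le_map_closest` applies.
  set T : (Fin n → EuclideanSpace ℝ (Fin d)) → Fin m → EuclideanSpace ℝ (Fin d) :=
    fun w => closestVectors x a m fun j => x + a⁻¹ • w j with hT
  have hcv : Measurable (closestVectors (n := n) x a m) :=
    (measurable_closestVectors a m).comp measurable_prodMk_left
  have hTmeas : Measurable T := hcv.comp (by fun_prop)
  have hpi : (Measure.pi fun _ : Fin n => ρ).map (fun y j => a • (y j - x)) =
      Measure.pi fun _ => ρ' := by
    have : SigmaFinite (ρ.map fun y => a • (y - x)) := by rw [hρ']; infer_instance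
    rw [Measure.pi_map_pi fun _ => hTm.aemeasurable, hρ']
  have hmap : (Measure.pi fun _ : Fin n => ρ).map (closestVectors x a m) =
      (Measure.pi fun _ : Fin n => ρ').map T := by
    rw [← hpi, Measure.map_map hTmeas (by fun_prop)]
    congr 1
    ext1 y
    simp only [hT, Function.comp_apply, hinv]
  have hinv' : ∀ w : EuclideanSpace ℝ (Fin d), a • (x + a⁻¹ • w - x) = w := fun w => by
    rw [add_sub_cancel_left, smul_smul, mul_inv_cancel₀ ha.ne', one_smul]
  rw [hmap]
  refine lintegral_le_map_closest ρ' hTmeas (fun σ w h1 h2 => ?_) hA hAmono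
  have := closestVectors_eq_of_strictMono x ha σ (fun j => x + a⁻¹ • w j)
  simp only [hinv'] at this
  exact this h1 h2

/-! ### Comparison of densities -/

theorem exp_neg_le_one_sub {u : ℝ} (h0 : 0 ≤ u) (h1 : u ≤ 1 / 2) :
    Real.exp (-(u + u ^ 2)) ≤ 1 - u := by
  have hpos : 0 < 1 - u := by linarith
  rw [Real.exp_neg]
  refine inv_le_of_inv_le₀ hpos ?_
  have h2 : 1 + (u + u ^ 2) + (u + u ^ 2) ^ 2 / 2 ≤ Real.exp (u + u ^ 2) :=
    Real.quadratic_le_exp_of_nonneg (by positivity)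
  refine le_trans ?_ h2
  rw [inv_le_iff_one_le_mul₀ hpos]
  nlinarith [mul_nonneg (sq_nonneg u) (sub_nonneg.2 h1), pow_nonneg h0 3, pow_nonneg h0 4,
    mul_nonneg (pow_nonneg h0 3) (sub_nonneg.2 h1), mul_nonneg (pow_nonneg h0 4) (sub_nonneg.2 h1)]

/-- With `N = n + 1`, the loss against `exp (-t)` factors as `p * q * r`: `p` from the falling
factorial, `q` from the density error at the `m` neighbours, `r` from replacing a power of `1 - u`
by an exponential. Each factor is at most 1 and close to 1, so the losses add up. -/
theorem binomial_density_lower_bound {n m : ℕ} (hmn : m ≤ n) {η L t : ℝ} (hη0 : 0 ≤ η) (hη1 : η ≤ 1)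
    (hL : 4 * L ≤ n + 1) (ht0 : 0 ≤ t) (htL : t ≤ L) :
    (1 - ((m : ℝ) ^ 2 / (n + 1) + m * η + η * L + 4 * L ^ 2 / (n + 1))) * Real.exp (-t) ≤
      n.descFactorial m *
        (((1 - η) / (n + 1)) ^ m * (1 - (1 + η) * t / (n + 1)) ^ (n - m)) := by
  set N : ℝ := n + 1 with hN
  have hNpos : 0 < N := by positivity
  have hmN : (m : ℝ) ≤ N := by
    have : (m : ℝ) ≤ n := by exact_mod_cast hmn
    linarith
  have hL0 : 0 ≤ L := ht0.trans htL
  set u := (1 + η) * t / N with hu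
  have hu0 : 0 ≤ u := by positivity
  -- `(1 + η) * t ≤ 2 * L ≤ N / 2`.
  have hu1 : u ≤ 1 / 2 := by
    rw [hu, div_le_iff₀ hNpos]
    nlinarith
  set p := (1 - (m : ℝ) / N) ^ m with hp
  set q := (1 - η) ^ m with hq
  set r := Real.exp (-(η * L + 4 * L ^ 2 / N)) with hr
  have hmN' : (m : ℝ) / N ≤ 1 := (div_le_one hNpos).2 hmN
  have hp0 : 0 ≤ p := pow_nonneg (by linarith) _
  have hp1 : p ≤ 1 := pow_le_one₀ (by linarith) (by linarith [div_nonneg (Nat.cast_nonneg m) hNpos.le])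
  have hq0 : 0 ≤ q := pow_nonneg (by linarith) _
  have hq1 : q ≤ 1 := pow_le_one₀ (by linarith) (by linarith)
  have hr1 : r ≤ 1 := Real.exp_le_one_iff.2 (neg_nonpos.2 (by positivity))
  have hp2 : 1 - (m : ℝ) ^ 2 / N ≤ p := by
    have := one_add_mul_le_pow (a := -((m : ℝ) / N)) (by linarith) m
    rw [hp, sub_eq_add_neg 1 ((m : ℝ) / N)]
    refine le_trans (le_of_eq ?_) this
    ring
  have hq2 : 1 - m * η ≤ q := by
    have := one_add_mul_le_pow (a := -η) (by linarith) m
    rw [hq, sub_eq_add_neg 1 η]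
    refine le_trans (le_of_eq ?_) this
    ring
  have hr2 : 1 - (η * L + 4 * L ^ 2 / N) ≤ r := Real.one_sub_le_exp_neg _
  have hpqr : 1 - ((m : ℝ) ^ 2 / N + m * η + η * L + 4 * L ^ 2 / N) ≤ p * q * r := by
    have h1 : p + q - 1 ≤ p * q := by nlinarith
    have h2 : p * q ≤ 1 := mul_le_one₀ hp1 hq0 hq1
    have h3 : p * q + r - 1 ≤ p * q * r := by nlinarith
    linarith
  have hdesc : (N - m) ^ m ≤ (n.descFactorial m : ℝ) := by
    have := Nat.pow_sub_le_descFactorial n m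
    have h' : ((n + 1 - m : ℕ) : ℝ) = N - m := by
      rw [Nat.cast_sub (by omega)]; push_cast; ring
    rw [← h']
    exact_mod_cast this
  have hexp : r * Real.exp (-t) ≤ (1 - u) ^ (n - m) := by
    calc r * Real.exp (-t) = Real.exp (-(η * L + 4 * L ^ 2 / N + t)) := by
          rw [hr, ← Real.exp_add]; congr 1; ring
      _ ≤ Real.exp (N * -(u + u ^ 2)) := by
          refine Real.exp_le_exp.2 ?_
          have e1 : N * u = (1 + η) * t := by rw [hu]; field_simp
          have e2 : N * u ^ 2 = ((1 + η) * t) ^ 2 / N := by rw [hu]; field_simp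
          -- The second-order term of the logarithm, summed over `N` factors.
          have e3 : ((1 + η) * t) ^ 2 / N ≤ 4 * L ^ 2 / N := by
            have : ((1 + η) * t) ^ 2 ≤ (2 * L) ^ 2 := by gcongr; linarith
            gcongr
            linarith
          have e4 : η * t ≤ η * L := by gcongr
          have e5 : N * -(u + u ^ 2) = -(N * u + N * u ^ 2) := by ring
          rw [e5, e1, e2]
          linarith
      _ = Real.exp (-(u + u ^ 2)) ^ (n + 1) := by
          rw [← Real.exp_nat_mul]; congr 1; push_cast; rw [hN]
      _ ≤ (1 - u) ^ (n + 1) := by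
          gcongr
          exact exp_neg_le_one_sub hu0 hu1
      _ ≤ (1 - u) ^ (n - m) := pow_le_pow_of_le_one (by linarith) (by linarith) (by omega)
  calc (1 - ((m : ℝ) ^ 2 / N + m * η + η * L + 4 * L ^ 2 / N)) * Real.exp (-t)
      ≤ p * q * r * Real.exp (-t) := by gcongr
    _ = p * q * (r * Real.exp (-t)) := by ring
    _ ≤ p * q * (1 - u) ^ (n - m) := by gcongr
    _ = (N - m) ^ m * (((1 - η) / N) ^ m * (1 - u) ^ (n - m)) := by
        have : (1 - (m : ℝ) / N) = (N - m) / N := by field_simp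
        rw [hp, hq, this, div_pow, div_pow]
        ring
    _ ≤ _ := by
        have : 0 ≤ (1 - η) / N := div_nonneg (by linarith) hNpos.le
        have h2 : 0 ≤ 1 - u := by linarith
        gcongr

theorem ballVolume_closedBall {d : ℕ} {r : ℝ} (hr : 0 ≤ r) :
    ballVolume d (Metric.closedBall 0 r) = ENNReal.ofReal (r ^ d) := by
  rw [ballVolume, Measure.smul_apply, Measure.addHaar_closedBall _ _ hr, finrank_euclideanSpace,
    Fintype.card_fin, smul_eq_mul, mul_comm, mul_assoc, ENNReal.mul_inv_cancel
      (Metric.measure_ball_pos volume _ one_pos).ne' measure_ball_lt_top.ne, mul_one]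

/-- The density of a scaled and centered point with respect to `ballVolume`. -/
theorem map_smul_sub_densityMeasure {d : ℕ} (f : EuclideanSpace ℝ (Fin d) → ℝ)
    (hf : Measurable f) (x : EuclideanSpace ℝ (Fin d)) {a b : ℝ} (ha : 0 < a)
    (hb : 0 < b) (hab : a ^ d = unitBallVolume d * b) :
    (densityMeasure f).map (fun y => a • (y - x)) =
      (ballVolume d).withDensity fun w => ENNReal.ofReal (f (x + a⁻¹ • w) / b) := by
  set T : EuclideanSpace ℝ (Fin d) → EuclideanSpace ℝ (Fin d) := fun y => a • (y - x) with hT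
  have hTm : Measurable T := by fun_prop
  set g : EuclideanSpace ℝ (Fin d) → ℝ≥0∞ := fun w => ENNReal.ofReal (f (x + a⁻¹ • w)) with hg
  have hgm : Measurable g := by fun_prop
  have hinv : ∀ y, x + a⁻¹ • T y = y := fun y => by
    simp only [hT]
    rw [smul_smul, inv_mul_cancel₀ ha.ne', one_smul, add_sub_cancel]
  have h1 : densityMeasure f = volume.withDensity fun y => g (T y) := by
    simp only [densityMeasure, hg, hinv]
  have h2 : (volume : Measure (EuclideanSpace ℝ (Fin d))).map T =
      ENNReal.ofReal ((a ^ d)⁻¹) • volume := by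
    have : T = (fun y => a • y) ∘ fun y => y - x := rfl
    rw [this, ← Measure.map_map (by fun_prop) (by fun_prop),
      (measurePreserving_sub_right volume x).map_eq, Measure.map_addHaar_smul _ ha.ne',
      finrank_euclideanSpace, Fintype.card_fin, abs_of_pos (by positivity)]
  have hc0 : (volume (Metric.ball (0 : EuclideanSpace ℝ (Fin d)) 1)) ≠ 0 :=
    (Metric.measure_ball_pos volume _ one_pos).ne'
  have hc1 : (volume (Metric.ball (0 : EuclideanSpace ℝ (Fin d)) 1)) ≠ ∞ := measure_ball_lt_top.ne
  have hc : 0 < unitBallVolume d := ENNReal.toReal_pos hc0 hc1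
  have h3 : (fun w => ENNReal.ofReal (f (x + a⁻¹ • w) / b)) = ENNReal.ofReal b⁻¹ • g := by
    ext1 w
    rw [Pi.smul_apply, smul_eq_mul, hg, div_eq_inv_mul, ENNReal.ofReal_mul (by positivity)]
  -- The Jacobian `(a ^ d)⁻¹` splits into the normalization of `ballVolume` and the divisor `b` of
  -- the density.
  rw [h1, map_withDensity_comp _ hTm hgm, h2, h3, withDensity_smul_measure, withDensity_smul _ hgm,
    ballVolume, withDensity_smul_measure, smul_smul, hab]
  congr 1
  rw [mul_inv, mul_comm, ENNReal.ofReal_mul (by positivity), ENNReal.ofReal_inv_of_pos hc,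
    unitBallVolume, Measure.real, ENNReal.ofReal_toReal hc1]

/-- If `f` is within a factor `1 ± η` of `f x` near `x`, the law of the scaled nearest-neighbour
vectors has almost the density `exp (-‖z‖^d)`, from below. -/
theorem exp_density_le_map_closestVectors {d n m : ℕ} (f : EuclideanSpace ℝ (Fin d) → ℝ)
    (hf : Measurable f) [IsProbabilityMeasure (densityMeasure f)] (x : EuclideanSpace ℝ (Fin d))
    (hfx : 0 < f x) {a η L : ℝ} (ha : 0 < a) (had : a ^ d = unitBallVolume d * ((n + 1) * f x))
    (hη0 : 0 ≤ η) (hη1 : η ≤ 1)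
    (hη : ∀ w : EuclideanSpace ℝ (Fin d), ‖w‖ ^ d ≤ L → |f (x + a⁻¹ • w) - f x| ≤ η * f x)
    (hmn : m ≤ n) (hL : 4 * L ≤ n + 1)
    {A : Set (Fin m → EuclideanSpace ℝ (Fin d))} (hA : MeasurableSet A)
    (hAmono : ∀ z ∈ A, StrictMono fun k => ‖z k‖) (hAL : ∀ z ∈ A, ‖z‖ ^ d ≤ L) :
    ENNReal.ofReal (1 - ((m : ℝ) ^ 2 / (n + 1) + m * η + η * L + 4 * L ^ 2 / (n + 1))) *
        ((Measure.pi fun _ => ballVolume d).withDensity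
          fun z => ENNReal.ofReal (Real.exp (-‖z‖ ^ d))) A ≤
      (Measure.pi fun _ : Fin n => densityMeasure f).map (closestVectors x a m) A := by
  have hNpos : (0 : ℝ) < n + 1 := by positivity
  set b := ((n : ℝ) + 1) * f x with hb
  have hbpos : 0 < b := by positivity
  set h : EuclideanSpace ℝ (Fin d) → ℝ≥0∞ := fun w => ENNReal.ofReal (f (x + a⁻¹ • w) / b) with hh
  have hhm : Measurable h := by fun_prop
  set ρ' := (ballVolume d).withDensity h with hρ'
  have hmap := map_smul_sub_densityMeasure f hf x ha hbpos had
  have hTm : Measurable fun y : EuclideanSpace ℝ (Fin d) => a • (y - x) := by fun_prop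
  have hprob : IsProbabilityMeasure ρ' := by
    rw [hρ', ← hmap]; exact Measure.isProbabilityMeasure_map hTm.aemeasurable
  -- As `b = (n + 1) * f x`, the relative error `η` puts the scaled density within `(1 ± η) / (n +
  -- 1)`.
  have hup : ∀ w : EuclideanSpace ℝ (Fin d), ‖w‖ ^ d ≤ L →
      h w ≤ ENNReal.ofReal ((1 + η) / (n + 1)) := by
    intro w hw
    have := (abs_le.1 (hη w hw)).2
    refine ENNReal.ofReal_le_ofReal ?_
    rw [div_le_div_iff₀ hbpos hNpos, hb]
    nlinarith
  have hlow : ∀ w : EuclideanSpace ℝ (Fin d), ‖w‖ ^ d ≤ L →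
      ENNReal.ofReal ((1 - η) / (n + 1)) ≤ h w := by
    intro w hw
    have := (abs_le.1 (hη w hw)).1
    refine ENNReal.ofReal_le_ofReal ?_
    rw [div_le_div_iff₀ hNpos hbpos, hb]
    nlinarith
  have hball : ∀ r : ℝ, 0 ≤ r → r ^ d ≤ L →
      ρ' (Metric.closedBall 0 r) ≤ ENNReal.ofReal ((1 + η) * r ^ d / (n + 1)) := by
    intro r hr hrL
    rw [hρ', withDensity_apply _ Metric.isClosed_closedBall.measurableSet]
    calc ∫⁻ w in Metric.closedBall 0 r, h w ∂ballVolume d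
        ≤ ∫⁻ _ in Metric.closedBall 0 r, ENNReal.ofReal ((1 + η) / (n + 1)) ∂ballVolume d := by
          refine setLIntegral_mono' Metric.isClosed_closedBall.measurableSet fun w hw => hup w ?_
          have hw' : ‖w‖ ≤ r := by simpa using hw
          exact (pow_le_pow_left₀ (norm_nonneg _) hw' d).trans hrL
      _ = ENNReal.ofReal ((1 + η) * r ^ d / (n + 1)) := by
          rw [setLIntegral_const, ballVolume_closedBall hr, ← ENNReal.ofReal_mul (by positivity)]
          congr 1
          ring
  have hcompl : ∀ r : ℝ, 0 ≤ r → r ^ d ≤ L →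
      ENNReal.ofReal (1 - (1 + η) * r ^ d / (n + 1)) ≤ ρ' (Metric.closedBall 0 r)ᶜ := by
    intro r hr hrL
    rw [prob_compl_eq_one_sub Metric.isClosed_closedBall.measurableSet,
      ENNReal.ofReal_sub _ (by positivity), ENNReal.ofReal_one]
    exact tsub_le_tsub_left (hball r hr hrL) 1
  refine le_trans ?_ (lintegral_le_map_closestVectors (densityMeasure f) x ha ρ' hmap hA hAmono)
  have hexpm : Measurable fun z : Fin m → EuclideanSpace ℝ (Fin d) =>
    ENNReal.ofReal (Real.exp (-‖z‖ ^ d)) := by fun_prop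
  have hpm : Measurable fun z : Fin m → EuclideanSpace ℝ (Fin d) =>
    ENNReal.ofReal (1 - (1 + η) * ‖z‖ ^ d / (n + 1)) ^ (n - m) := by fun_prop
  have hprodm : Measurable fun z : Fin m → EuclideanSpace ℝ (Fin d) => ∏ i, h (z i) := by
    fun_prop
  calc _ = ∫⁻ z in A,
        ENNReal.ofReal (1 - ((m : ℝ) ^ 2 / (n + 1) + m * η + η * L + 4 * L ^ 2 / (n + 1))) *
          ENNReal.ofReal (Real.exp (-‖z‖ ^ d)) ∂(Measure.pi fun _ => ballVolume d) := by
        rw [withDensity_apply _ hA, lintegral_const_mul _ hexpm]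
    _ ≤ ∫⁻ z in A, (n.descFactorial m : ℝ≥0∞) * ((∏ i, h (z i)) *
          ENNReal.ofReal (1 - (1 + η) * ‖z‖ ^ d / (n + 1)) ^ (n - m))
            ∂(Measure.pi fun _ => ballVolume d) := by
        refine setLIntegral_mono' hA fun z hz => ?_
        have hzL := hAL z hz
        have hnum := binomial_density_lower_bound hmn hη0 hη1 hL
          (pow_nonneg (norm_nonneg z) d) hzL
        have hpr : ENNReal.ofReal ((1 - η) / (n + 1)) ^ m ≤ ∏ i, h (z i) := by
          have := Finset.prod_le_prod' (s := Finset.univ) (f := fun _ : Fin m =>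
            ENNReal.ofReal ((1 - η) / (n + 1))) (g := fun i => h (z i)) fun i _ =>
              hlow (z i) ((pow_le_pow_left₀ (norm_nonneg _) (norm_le_pi_norm z i) d).trans hzL)
          simpa using this
        have hu0 : 0 ≤ 1 - (1 + η) * ‖z‖ ^ d / (n + 1) := by
          rw [sub_nonneg, div_le_one hNpos]
          nlinarith [pow_nonneg (norm_nonneg z) d]
        have hη2 : 0 ≤ (1 - η) / ((n : ℝ) + 1) := div_nonneg (by linarith) hNpos.le
        rw [← ENNReal.ofReal_mul' (Real.exp_pos _).le]
        refine (ENNReal.ofReal_le_ofReal hnum).trans ?_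
        rw [ENNReal.ofReal_mul (by positivity), ENNReal.ofReal_mul (by positivity),
          ENNReal.ofReal_pow hη2, ENNReal.ofReal_pow hu0, ENNReal.ofReal_natCast]
        gcongr
    _ = (n.descFactorial m : ℝ≥0∞) * ∫⁻ z in A,
          ENNReal.ofReal (1 - (1 + η) * ‖z‖ ^ d / (n + 1)) ^ (n - m)
            ∂(Measure.pi fun _ => ρ') := by
        have hmul : Measurable fun z : Fin m → EuclideanSpace ℝ (Fin d) => (∏ i, h (z i)) *
            ENNReal.ofReal (1 - (1 + η) * ‖z‖ ^ d / (n + 1)) ^ (n - m) := hprodm.mul hpm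
        rw [lintegral_const_mul _ hmul, hρ', pi_withDensity _ _ hhm,
          setLIntegral_withDensity_eq_setLIntegral_mul _ hprodm hpm hA]
        rfl
    _ ≤ _ := by
        refine mul_le_mul' le_rfl ?_
        refine setLIntegral_mono' hA fun z hz => ?_
        gcongr
        exact hcompl _ (norm_nonneg _) (hAL z hz)

/-! ### The limit law on a general probability space -/

theorem partialSums_eq_sum_range {m : ℕ} (e : ℕ → ℝ) (ℓ : Fin m) :
    partialSums (fun j : Fin m => e j) ℓ = ∑ j ∈ Finset.range ((ℓ : ℕ) + 1), e j := by
  rw [partialSums, Nat.range_succ_eq_Iic, ← Fin.map_valEmbedding_Iic, Finset.sum_map]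
  rfl

/-- The tuples of points with increasing norms, all of norm at most `L^{1/d}`. -/
def increasingNorms (d m : ℕ) (L : ℝ) : Set (Fin m → EuclideanSpace ℝ (Fin d)) :=
  {z | StrictMono (fun k => ‖z k‖) ∧ ‖z‖ ^ d ≤ L}

theorem measurableSet_increasingNorms (d m : ℕ) (L : ℝ) :
    MeasurableSet (increasingNorms d m L) := by
  have hnorm : Measurable fun z : Fin m → EuclideanSpace ℝ (Fin d) => ‖z‖ ^ d := by fun_prop
  refine MeasurableSet.inter ?_ (measurableSet_le hnorm measurable_const)
  change MeasurableSet {z : Fin m → EuclideanSpace ℝ (Fin d) | ∀ k l, k < l → ‖z k‖ < ‖z l‖}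
  simp only [Set.ofPred_forall]
  exact MeasurableSet.iInter fun k => MeasurableSet.iInter fun l => MeasurableSet.iInter fun _ =>
    measurableSet_lt (by fun_prop) (by fun_prop)

section Target

variable {d : ℕ} {Ω' : Type*} [MeasurableSpace Ω'] (Q : Measure Ω')
  (E : ℕ → Ω' → ℝ) (ξ : ℕ → Ω' → Metric.sphere (0 : EuclideanSpace ℝ (Fin d)) 1)

theorem aemeasurable_poisson_points (hE_law : ∀ j, HasLaw (E j) (expMeasure 1) Q)
    (hξ_law : ∀ j, HasLaw (ξ j) (uniformSphere d) Q) (m : ℕ) :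
    AEMeasurable (fun ω (ℓ : Fin m) => (∑ j ∈ Finset.range ((ℓ : ℕ) + 1), E j ω) ^ (1 / (d : ℝ)) •
      (ξ ℓ ω : EuclideanSpace ℝ (Fin d))) Q := by
  have hE : ∀ j, AEMeasurable (E j) Q := fun j => (hE_law j).aemeasurable
  have hξ : ∀ j, AEMeasurable (ξ j) Q := fun j => (hξ_law j).aemeasurable
  refine aemeasurable_pi_lambda _ fun ℓ => AEMeasurable.fun_smul ?_ ?_
  · exact (Finset.aemeasurable_fun_sum _ fun j _ => hE j).pow_const _
  · exact measurable_subtype_coe.comp_aemeasurable (hξ ℓ)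

theorem map_poisson_points_le_withDensity [IsProbabilityMeasure Q] (hd : 0 < d)
    (hE_law : ∀ j, HasLaw (E j) (expMeasure 1) Q) (hE_indep : iIndepFun E Q)
    (hξ_law : ∀ j, HasLaw (ξ j) (uniformSphere d) Q) (hξ_indep : iIndepFun ξ Q)
    (hEξ_indep : IndepFun (fun ω j => E j ω) (fun ω j => ξ j ω) Q) (m : ℕ) :
    Q.map (fun ω (ℓ : Fin m) => (∑ j ∈ Finset.range ((ℓ : ℕ) + 1), E j ω) ^ (1 / (d : ℝ)) •
      (ξ ℓ ω : EuclideanSpace ℝ (Fin d))) ≤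
    (Measure.pi fun _ => ballVolume d).withDensity
      fun z => ENNReal.ofReal (Real.exp (-‖z‖ ^ d)) := by
  have hprob := isProbabilityMeasure_expMeasure one_pos
  have hsph : IsProbabilityMeasure (uniformSphere d) :=
    (hξ_law 0).isProbabilityMeasure_iff.1 inferInstance
  have hE' : HasLaw (fun ω (j : Fin m) => E j ω) (Measure.pi fun _ => expMeasure 1) Q :=
    (hE_indep.precomp (g := fun j : Fin m => (j : ℕ)) Fin.val_injective).hasLaw_pi
      fun j => hE_law j
  have hξ' : HasLaw (fun ω (j : Fin m) => ξ j ω) (Measure.pi fun _ => uniformSphere d) Q :=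
    (hξ_indep.precomp (g := fun j : Fin m => (j : ℕ)) Fin.val_injective).hasLaw_pi
      fun j => hξ_law j
  have hind : IndepFun (fun ω (j : Fin m) => E j ω) (fun ω (j : Fin m) => ξ j ω) Q :=
    hEξ_indep.comp (φ := fun (e : ℕ → ℝ) (j : Fin m) => e j)
      (ψ := fun (u : ℕ → Metric.sphere (0 : EuclideanSpace ℝ (Fin d)) 1) (j : Fin m) => u j)
      (by fun_prop) (by fun_prop)
  have hlaw := (indepFun_iff_hasLaw_prodMk_prod hE' hξ').1 hind
  refine le_trans (le_of_eq ?_) (map_poisson_points_le hd m)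
  have hS := measurable_partialSums (m := m)
  have hG : Measurable fun (p : (Fin m → ℝ) × (Fin m → Metric.sphere (0 : EuclideanSpace ℝ (Fin d)) 1))
      (ℓ : Fin m) => partialSums p.1 ℓ ^ (1 / (d : ℝ)) • (p.2 ℓ : EuclideanSpace ℝ (Fin d)) := by
    fun_prop
  rw [← hlaw.map_eq, AEMeasurable.map_map_of_aemeasurable hG.aemeasurable hlaw.aemeasurable]
  congr 1
  ext1 ω
  ext1 ℓ
  simp only [Function.comp_apply]
  rw [partialSums_eq_sum_range fun j => E j ω]

/-- Almost surely the `E j` are positive, so the radii strictly increase and the event forces `E 0 +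
⋯ + E (m - 1) ≥ L`. This sum has mean `m`, and Markov's inequality applies. -/
theorem map_poisson_points_compl_le (hd : 0 < d)
    (hE_law : ∀ j, HasLaw (E j) (expMeasure 1) Q)
    (hξ_law : ∀ j, HasLaw (ξ j) (uniformSphere d) Q) (m : ℕ) {L : ℝ} (hL : 0 < L) :
    (Q.map (fun ω (ℓ : Fin m) => (∑ j ∈ Finset.range ((ℓ : ℕ) + 1), E j ω) ^ (1 / (d : ℝ)) •
      (ξ ℓ ω : EuclideanSpace ℝ (Fin d)))).real (increasingNorms d m L)ᶜ ≤ m / L := by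
  have hd' : (d : ℝ) ≠ 0 := by positivity
  have hpos : ∀ᵐ ω ∂Q, ∀ j, 0 < E j ω := ae_all_iff.2 fun j =>
    ((hE_law j).ae_iff (p := fun x => 0 < x) (measurableSet_Ioi.mem)).2 expMeasure_ae_pos
  have hEm : ∀ j, AEMeasurable (E j) Q := fun j => (hE_law j).aemeasurable
  have hle : Q.map (fun ω (ℓ : Fin m) =>
      (∑ j ∈ Finset.range ((ℓ : ℕ) + 1), E j ω) ^ (1 / (d : ℝ)) •
      (ξ ℓ ω : EuclideanSpace ℝ (Fin d))) (increasingNorms d m L)ᶜ ≤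
      Q {ω | ENNReal.ofReal L ≤ ∑ j ∈ Finset.range m, ENNReal.ofReal (E j ω)} := by
    rw [Measure.map_apply_of_aemeasurable (aemeasurable_poisson_points Q E ξ hE_law hξ_law m)
      (measurableSet_increasingNorms d m L).compl]
    refine measure_mono_ae ?_
    filter_upwards [hpos] with ω hω hmem
    have hnorm : ∀ ℓ : Fin m, ‖(∑ j ∈ Finset.range ((ℓ : ℕ) + 1), E j ω) ^ (1 / (d : ℝ)) •
        (ξ ℓ ω : EuclideanSpace ℝ (Fin d))‖ =
        (∑ j ∈ Finset.range ((ℓ : ℕ) + 1), E j ω) ^ (1 / (d : ℝ)) := by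
      intro ℓ
      rw [norm_smul, norm_eq_of_mem_sphere, mul_one, Real.norm_of_nonneg]
      exact Real.rpow_nonneg (Finset.sum_nonneg fun j _ => (hω j).le) _
    change ENNReal.ofReal L ≤ _
    rw [← ENNReal.ofReal_sum_of_nonneg fun j _ => (hω j).le]
    refine ENNReal.ofReal_le_ofReal ?_
    by_contra hcon
    push Not at hcon
    refine hmem ⟨fun k l hkl => ?_, ?_⟩
    · simp only [hnorm]
      refine Real.rpow_lt_rpow (Finset.sum_nonneg fun j _ => (hω j).le) ?_ (by positivity)
      refine Finset.sum_lt_sum_of_subset (i := (l : ℕ)) ?_ ?_ ?_ (hω _) fun j _ _ => (hω j).le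
      · exact Finset.range_subset_range.2 (by omega)
      · simp
      · simpa using hkl
    · have hS0 : 0 ≤ ∑ j ∈ Finset.range m, E j ω := Finset.sum_nonneg fun j _ => (hω j).le
      have : ‖fun ℓ : Fin m => (∑ j ∈ Finset.range ((ℓ : ℕ) + 1), E j ω) ^ (1 / (d : ℝ)) •
          (ξ ℓ ω : EuclideanSpace ℝ (Fin d))‖ ≤
          (∑ j ∈ Finset.range m, E j ω) ^ (1 / (d : ℝ)) := by
        refine (pi_norm_le_iff_of_nonneg (by positivity)).2 fun ℓ => ?_
        rw [hnorm]
        refine Real.rpow_le_rpow (Finset.sum_nonneg fun j _ => (hω j).le) ?_ (by positivity)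
        exact Finset.sum_le_sum_of_subset_of_nonneg (Finset.range_subset_range.2 (by omega))
          fun j _ _ => (hω j).le
      refine (pow_le_pow_left₀ (norm_nonneg _) this d).trans ?_
      rw [← Real.rpow_natCast, ← Real.rpow_mul hS0, one_div_mul_cancel hd', Real.rpow_one]
      exact hcon.le
  have hsum : ∫⁻ ω, ∑ j ∈ Finset.range m, ENNReal.ofReal (E j ω) ∂Q = m := by
    rw [lintegral_finsetSum' _ fun j _ => (hEm j).ennreal_ofReal]
    have : ∀ j, ∫⁻ ω, ENNReal.ofReal (E j ω) ∂Q = 1 := fun j => by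
      rw [← lintegral_ofReal_expMeasure]
      exact (hE_law j).lintegral_comp (f := ENNReal.ofReal) (by fun_prop)
    simp [this]
  have hmarkov := mul_meas_ge_le_lintegral₀ (μ := Q)
    (f := fun ω => ∑ j ∈ Finset.range m, ENNReal.ofReal (E j ω))
    (Finset.aemeasurable_fun_sum _ fun j _ => (hEm j).ennreal_ofReal) (ENNReal.ofReal L)
  rw [hsum] at hmarkov
  have hfin : ENNReal.ofReal L * Q.map (fun ω (ℓ : Fin m) =>
      (∑ j ∈ Finset.range ((ℓ : ℕ) + 1), E j ω) ^ (1 / (d : ℝ)) •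
      (ξ ℓ ω : EuclideanSpace ℝ (Fin d))) (increasingNorms d m L)ᶜ ≤ m :=
    (mul_le_mul' le_rfl hle).trans hmarkov
  have := ENNReal.toReal_mono (ENNReal.natCast_ne_top m) hfin
  rw [ENNReal.toReal_mul, ENNReal.toReal_ofReal hL.le, ENNReal.toReal_natCast] at this
  rw [le_div_iff₀ hL, mul_comm]
  exact this

end Target

/-! ### Quantitative bound and limit -/

/-- Mean value inequality on the convex ball, the gradient bound being the Lipschitz constant. -/
theorem exists_abs_sub_le_mul_norm {d : ℕ} (f : EuclideanSpace ℝ (Fin d) → ℝ)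
    (x : EuclideanSpace ℝ (Fin d)) {ε : ℝ} (hε : 0 < ε)
    (hf_C2 : ContDiffOn ℝ 2 f (Metric.ball x ε))
    (hf_grad : ∃ C : ℝ, ∀ a ∈ Metric.ball x ε, ‖gradient f a‖ ≤ C) :
    ∃ C : ℝ, 0 ≤ C ∧ ∀ v, ‖v‖ < ε → |f (x + v) - f x| ≤ C * ‖v‖ := by
  obtain ⟨C, hC⟩ := hf_grad
  have hx : x ∈ Metric.ball x ε := Metric.mem_ball_self hε
  refine ⟨C, (norm_nonneg _).trans (hC x hx), fun v hv => ?_⟩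
  have hdiff : ∀ a ∈ Metric.ball x ε, DifferentiableAt ℝ f a := fun a ha =>
    (hf_C2.contDiffAt (Metric.isOpen_ball.mem_nhds ha)).differentiableAt (by norm_num)
  have hbound : ∀ a ∈ Metric.ball x ε, ‖fderiv ℝ f a‖ ≤ C := fun a ha => by
    have := hC a ha
    rwa [gradient, LinearIsometryEquiv.norm_map] at this
  have hmem : x + v ∈ Metric.ball x ε := by simpa [Metric.mem_ball, dist_eq_norm] using hv
  have := (convex_ball x ε).norm_image_sub_le_of_norm_fderiv_le hdiff hbound hx hmem
  simpa using this

/-- The first four terms are the loss `1 - c` in the density comparison on `increasingNorms`; the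
last is the mass of the limit law outside it. -/
theorem tvDist_closestVectors_le {d n m : ℕ} (hd : 0 < d) (f : EuclideanSpace ℝ (Fin d) → ℝ)
    (hf : Measurable f) [IsProbabilityMeasure (densityMeasure f)]
    {Ω' : Type*} [MeasurableSpace Ω'] (Q : Measure Ω') [IsProbabilityMeasure Q]
    (E : ℕ → Ω' → ℝ) (ξ : ℕ → Ω' → Metric.sphere (0 : EuclideanSpace ℝ (Fin d)) 1)
    (hE_law : ∀ j, HasLaw (E j) (expMeasure 1) Q) (hE_indep : iIndepFun E Q)
    (hξ_law : ∀ j, HasLaw (ξ j) (uniformSphere d) Q) (hξ_indep : iIndepFun ξ Q)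
    (hEξ_indep : IndepFun (fun ω j => E j ω) (fun ω j => ξ j ω) Q)
    (x : EuclideanSpace ℝ (Fin d))
    (hfx : 0 < f x) {a η L : ℝ} (ha : 0 < a) (had : a ^ d = unitBallVolume d * ((n + 1) * f x))
    (hη0 : 0 ≤ η) (hη1 : η ≤ 1)
    (hη : ∀ w : EuclideanSpace ℝ (Fin d), ‖w‖ ^ d ≤ L → |f (x + a⁻¹ • w) - f x| ≤ η * f x)
    (hmn : m ≤ n) (hL0 : 0 < L) (hL : 4 * L ≤ n + 1) :
    tvDist ((Measure.pi fun _ : Fin n => densityMeasure f).map (closestVectors x a m))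
        (Q.map fun ω (ℓ : Fin m) =>
          (∑ j ∈ Finset.range ((ℓ : ℕ) + 1), E j ω) ^ (1 / (d : ℝ)) •
            (ξ ℓ ω : EuclideanSpace ℝ (Fin d))) ≤
      (m : ℝ) ^ 2 / (n + 1) + m * η + η * L + 4 * L ^ 2 / (n + 1) + m / L := by
  have hcv : Measurable (closestVectors (n := n) x a m) :=
    (measurable_closestVectors a m).comp measurable_prodMk_left
  have hμ := Measure.isProbabilityMeasure_map
    (μ := Measure.pi fun _ : Fin n => densityMeasure f) hcv.aemeasurable
  have hν := Measure.isProbabilityMeasure_map (μ := Q)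
    (aemeasurable_poisson_points Q E ξ hE_law hξ_law m)
  set c : ℝ := 1 - ((m : ℝ) ^ 2 / (n + 1) + m * η + η * L + 4 * L ^ 2 / (n + 1)) with hc
  have hc1 : c ≤ 1 := by
    have : 0 ≤ (m : ℝ) ^ 2 / (n + 1) + m * η + η * L + 4 * L ^ 2 / (n + 1) := by positivity
    linarith
  have hlaw := map_poisson_points_le_withDensity Q E ξ hd hE_law hE_indep hξ_law hξ_indep
    hEξ_indep m
  refine (tvDist_le_of_le_on _ _ (measurableSet_increasingNorms d m L) hc1 fun A hA hAG => ?_).trans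
    (add_le_add (le_of_eq (by rw [hc]; ring))
      (map_poisson_points_compl_le Q E ξ hd hE_law hξ_law m hL0))
  have h1 := exp_density_le_map_closestVectors f hf x hfx ha had hη0 hη1 hη hmn hL hA
    (fun z hz => (hAG hz).1) fun z hz => (hAG hz).2
  have h2 := (mul_le_mul' le_rfl (hlaw A)).trans h1
  have h3 := ENNReal.toReal_mono (measure_ne_top _ _) h2
  rw [ENNReal.toReal_mul] at h3
  refine le_trans ?_ h3
  refine mul_le_mul_of_nonneg_right ?_ ENNReal.toReal_nonneg
  -- The constant `c` may be negative; `ENNReal.ofReal` then truncates it to 0, which only increases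
  -- it.
  rw [ENNReal.toReal_ofReal']
  exact le_max_left _ _

theorem tendsto_log_pow_div (k : ℕ) :
    Tendsto (fun n : ℕ => Real.log ((n : ℝ) + 1) ^ k / ((n : ℝ) + 1)) atTop (𝓝 0) := by
  have h := (Real.isLittleO_pow_log_id_atTop (n := k)).tendsto_div_nhds_zero
  exact h.comp (tendsto_atTop_add_const_right _ 1 tendsto_natCast_atTop_atTop)

/-- The factor `log ^ 2` moves inside the `d`-th root as `log ^ (2 * d)`, and any power of the
logarithm is negligible against `n`. -/
theorem tendsto_rpow_log_sq {d : ℕ} (hd : 0 < d) {b : ℝ} (hb : 0 < b) :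
    Tendsto (fun n : ℕ => (Real.log ((n : ℝ) + 1) ^ 2 / (b * ((n : ℝ) + 1))) ^ (1 / (d : ℝ)) *
      Real.log ((n : ℝ) + 1) ^ 2) atTop (𝓝 0) := by
  have hd' : (0 : ℝ) < 1 / d := by positivity
  have h := ((tendsto_log_pow_div (2 + 2 * d)).const_mul b⁻¹).rpow_const (p := 1 / (d : ℝ))
    (Or.inr hd'.le)
  rw [mul_zero, Real.zero_rpow hd'.ne'] at h
  refine h.congr fun n => ?_
  set l := Real.log ((n : ℝ) + 1)
  have e : b⁻¹ * (l ^ (2 + 2 * d) / ((n : ℝ) + 1)) = l ^ 2 / (b * ((n : ℝ) + 1)) * (l ^ 2) ^ d := by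
    rw [pow_add, pow_mul]
    field_simp
  rw [e, Real.mul_rpow (by positivity) (by positivity)]
  congr 1
  rw [one_div, Real.pow_rpow_inv_natCast (by positivity) hd.ne']

theorem lemma1 {d : ℕ} (hd : 0 < d)
    -- the samples: i.i.d. with density `f`
    (f : EuclideanSpace ℝ (Fin d) → ℝ) (hf_meas : Measurable f) (hf_nonneg : ∀ y, 0 ≤ f y)
    {Ω : Type*} [MeasurableSpace Ω] (P : Measure Ω) [IsProbabilityMeasure P]
    (X : ℕ → Ω → EuclideanSpace ℝ (Fin d))
    (hX_law : ∀ j, HasLaw (X j) (densityMeasure f) P) (hX_indep : iIndepFun X P)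
    -- the exponential variables and the uniform directions
    {Ω' : Type*} [MeasurableSpace Ω'] (Q : Measure Ω') [IsProbabilityMeasure Q]
    (E : ℕ → Ω' → ℝ) (ξ : ℕ → Ω' → Metric.sphere (0 : EuclideanSpace ℝ (Fin d)) 1)
    (hE_law : ∀ j, HasLaw (E j) (expMeasure 1) Q) (hE_indep : iIndepFun E Q)
    (hξ_law : ∀ j, HasLaw (ξ j) (uniformSphere d) Q) (hξ_indep : iIndepFun ξ Q)
    (hEξ_indep : IndepFun (fun ω j => E j ω) (fun ω j => ξ j ω) Q)
    -- the local assumptions at `x`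
    (x : EuclideanSpace ℝ (Fin d)) (ε : ℝ) (hε : 0 < ε)
    (hf_C2 : ContDiffOn ℝ 2 f (Metric.ball x ε))
    (hf_pos : ∀ a ∈ Metric.ball x ε, 0 < f a)
    (hf_grad : ∃ C : ℝ, ∀ a ∈ Metric.ball x ε, ‖gradient f a‖ ≤ C)
    (hf_hess : ∃ C : ℝ, ∀ a ∈ Metric.ball x ε, ‖fderiv ℝ (fderiv ℝ f) a‖ ≤ C)
    -- the number of neighbours (as a function of the sample size), and the conditioning index
    (m : ℕ → ℕ) (hm : (fun N : ℕ => (m N : ℝ)) =O[atTop] fun N : ℕ => Real.log N)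
    (i : (n : ℕ) → Fin (n + 1)) :
    -- `condSampleLaw` is the conditional law of the sample given its `k`-th point
    (∀ (n : ℕ) (k : Fin (n + 1)), ∀ᵐ z ∂(P.map (X k)),
      condDistrib (fun ω (j : Fin (n + 1)) => X j ω) (X k) P z =
        condSampleLaw (densityMeasure f) k z) ∧
    -- convergence in total variation; the sample size is `n + 1`
    Tendsto (fun n : ℕ =>
      tvDist
        ((condSampleLaw (densityMeasure f) (i n) x).map
          fun y (ℓ : Fin (m (n + 1))) =>
            (unitBallVolume d * ((n + 1 : ℕ) : ℝ) * f x) ^ (1 / (d : ℝ)) • nnVector y (i n) ℓ)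
        (Q.map fun ω (ℓ : Fin (m (n + 1))) =>
            (∑ j ∈ Finset.range ((ℓ : ℕ) + 1), E j ω) ^ (1 / (d : ℝ)) •
              (ξ ℓ ω : EuclideanSpace ℝ (Fin d))))
      atTop (𝓝 0) := by
  refine ⟨condDistrib_sample_ae_eq P X _ hX_law hX_indep, ?_⟩
  have hρ : IsProbabilityMeasure (densityMeasure f) :=
    (hX_law 0).isProbabilityMeasure_iff.1 inferInstance
  have hfx : 0 < f x := hf_pos x (Metric.mem_ball_self hε)
  obtain ⟨C, hC0, hC⟩ := exists_abs_sub_le_mul_norm f x hε hf_C2 hf_grad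
  have hcd : 0 < unitBallVolume d :=
    ENNReal.toReal_pos (Metric.measure_ball_pos volume _ one_pos).ne' measure_ball_lt_top.ne
  have hd' : (0 : ℝ) < 1 / d := by positivity
  set b := unitBallVolume d * f x with hb
  have hbpos : 0 < b := by positivity
  obtain ⟨M, hM0, hM⟩ := hm.exists_nonneg
  have hM' := (tendsto_add_atTop_nat 1).eventually hM.bound
  set l : ℕ → ℝ := fun n => Real.log ((n : ℝ) + 1) with hl
  -- The cutoff is `L = l n ^ 2`: larger in order than `m`, yet negligible against powers of `n`. `δ
  -- n` is the radius, before scaling, of the ball where `‖w‖ ^ d ≤ L`; the relative error is `η = C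
  -- / f x * δ n`.
  set δ : ℕ → ℝ := fun n => (l n ^ 2 / (b * ((n : ℝ) + 1))) ^ (1 / (d : ℝ)) with hδ
  have hδl : Tendsto (fun n => δ n * l n ^ 2) atTop (𝓝 0) := tendsto_rpow_log_sq hd hbpos
  have hltop : Tendsto l atTop atTop := Real.tendsto_log_atTop.comp
    (tendsto_atTop_add_const_right _ 1 tendsto_natCast_atTop_atTop)
  -- The summands majorize, in order, the five terms of `tvDist_closestVectors_le`.
  have hlim : Tendsto (fun n : ℕ => M ^ 2 * (l n ^ 2 / ((n : ℝ) + 1)) +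
      M * (C / f x) * (δ n * l n ^ 2) + C / f x * (δ n * l n ^ 2) +
      4 * (l n ^ 4 / ((n : ℝ) + 1)) + M * (l n)⁻¹) atTop (𝓝 0) := by
    have h := (((((tendsto_log_pow_div 2).const_mul (M ^ 2)).add (hδl.const_mul (M * (C / f x)))).add
      (hδl.const_mul (C / f x))).add ((tendsto_log_pow_div 4).const_mul 4)).add
      (hltop.inv_tendsto_atTop.const_mul M)
    simpa using h
  have hsmall := (hδl.const_mul (C / f x)).eventually
    (gt_mem_nhds (show C / f x * 0 < 1 by simp))
  have hLN := (tendsto_log_pow_div 2).eventually (gt_mem_nhds (show (0 : ℝ) < 1 / 4 by norm_num))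
  have hmN := ((tendsto_log_pow_div 1).const_mul M).eventually
    (gt_mem_nhds (show M * 0 < 1 by simp))
  refine squeeze_zero' (Eventually.of_forall fun n => tvDist_nonneg _ _) ?_ hlim
  filter_upwards [hM', hltop.eventually_ge_atTop 1, hδl.eventually (gt_mem_nhds hε), hsmall, hLN,
    hmN] with n hn1 hn2 hn3 hn4 hn5 hn6
  have hN : (0 : ℝ) < (n : ℝ) + 1 := by positivity
  have hδ0 : 0 ≤ δ n := by positivity
  have hl1 : 1 ≤ l n ^ 2 := one_le_pow₀ hn2
  have hδle : δ n ≤ δ n * l n ^ 2 := le_mul_of_one_le_right hδ0 hl1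
  have hml : (m (n + 1) : ℝ) ≤ M * l n := by
    rw [Real.norm_of_nonneg (by positivity), Real.norm_of_nonneg (Real.log_natCast_nonneg _)] at hn1
    simpa [hl] using hn1
  have hmn : m (n + 1) ≤ n := by
    have h1 : M * l n < n + 1 := by
      rw [pow_one, ← mul_div_assoc, div_lt_one hN] at hn6
      exact hn6
    have h2 : (m (n + 1) : ℝ) < ((n + 1 : ℕ) : ℝ) := by push_cast; linarith
    exact Nat.lt_succ_iff.1 (by exact_mod_cast h2)
  set a := (unitBallVolume d * ((n + 1 : ℕ) : ℝ) * f x) ^ (1 / (d : ℝ)) with ha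
  have hapos : 0 < a := by positivity
  have hab : a ^ d = b * ((n : ℝ) + 1) := by
    rw [ha, one_div, Real.rpow_inv_natCast_pow (by positivity) hd.ne', hb]
    push_cast
    ring
  have hη : ∀ w : EuclideanSpace ℝ (Fin d), ‖w‖ ^ d ≤ l n ^ 2 →
      |f (x + a⁻¹ • w) - f x| ≤ C / f x * δ n * f x := by
    intro w hw
    have hwδ : ‖a⁻¹ • w‖ ≤ δ n := by
      have hroot : ‖a⁻¹ • w‖ = ((a⁻¹ * ‖w‖) ^ d) ^ (1 / (d : ℝ)) := by
        rw [one_div, Real.pow_rpow_inv_natCast (by positivity) hd.ne', norm_smul, norm_inv,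
          Real.norm_of_nonneg hapos.le]
      rw [hroot]
      refine Real.rpow_le_rpow (by positivity) ?_ hd'.le
      rw [mul_pow, inv_pow, hab, ← div_eq_inv_mul]
      gcongr
    refine (hC _ (by linarith)).trans ?_
    have : C / f x * δ n * f x = C * δ n := by field_simp
    rw [this]
    gcongr
  have hfin := tvDist_closestVectors_le (m := m (n + 1)) hd f hf_meas Q E ξ hE_law hE_indep hξ_law
    hξ_indep hEξ_indep x hfx hapos (hab.trans (by rw [hb]; ring)) (by positivity)
    (by nlinarith [div_nonneg hC0 hfx.le] : C / f x * δ n ≤ 1) hη hmn (by linarith)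
    (by rw [div_lt_iff₀ hN] at hn5; linarith)
  rw [map_nnVector_condSampleLaw]
  refine hfin.trans ?_
  have hq : 0 ≤ C / f x := div_nonneg hC0 hfx.le
  have hlpos : 0 < l n := by linarith
  have t1 : (m (n + 1) : ℝ) ^ 2 / (n + 1) ≤ M ^ 2 * (l n ^ 2 / ((n : ℝ) + 1)) := by
    rw [← mul_div_assoc, ← mul_pow]
    gcongr
  have t2 : (m (n + 1) : ℝ) * (C / f x * δ n) ≤ M * (C / f x) * (δ n * l n ^ 2) := by
    have hl2 : l n ≤ l n ^ 2 := by nlinarith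
    calc (m (n + 1) : ℝ) * (C / f x * δ n) ≤ M * l n ^ 2 * (C / f x * δ n) := by
          gcongr
          exact hml.trans (by gcongr)
      _ = _ := by ring
  have t3 : C / f x * δ n * l n ^ 2 = C / f x * (δ n * l n ^ 2) := by ring
  have t4 : 4 * (l n ^ 2) ^ 2 / ((n : ℝ) + 1) = 4 * (l n ^ 4 / ((n : ℝ) + 1)) := by ring
  have t5 : (m (n + 1) : ℝ) / l n ^ 2 ≤ M * (l n)⁻¹ := by
    rw [div_le_iff₀ (by positivity)]
    refine hml.trans (le_of_eq ?_)
    field_simp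
  linarith
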